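/- Let $0\le t_0<T$, let $a,b:[t_0,T]\to\mathbb R$ be twice differentiable, let $W$ be a standard Brownian motion relative to a filtration $(\mathcal F_t)$ (adapted, with $W_t-W_s$ independent of $\mathcal F_s$ for $s\le t$), and let $X$ be a solution (adapted, with almost surely continuous paths) on $[t_0,T]$ of the scalar It\^o SDE $$dX=a(t)X\,dt+b(t)\,dW,\qquad E[X(t_0)^2]^{1/2}\le M<\infty .$$ Let $S_0,S_1,\dots$ be independent random signs, $S_k=\pm1$ with probability $\tfrac12$ each, independent of the filtration $(\mathcal F_t)$. One step of the Runge--Kutta like scheme with time step $h>0$, from the value $x$ at time $t$, with sign $S$ and $\Delta W=W(t+h)-W(t)$, is $$K_1=h\,a(t)x+(\Delta W-S\sqrt h)\,b(t),\quad K_2=h\,a(t+h)(x+K_1)+(\Delta W+S\sqrt h)\,b(t+h),\quad x\mapsto x+\tfrac12(K_1+K_2).$$ Let $X_0=X(t_0)$ and let $X_{k+1}$ be obtained from $X_k$ by one such step from time $t_0+kh$ with sign $S_k$. (1) There is a constant $C$, depending only on $a,b,t_0,T,M$, such that for all $h>0$ and integers $m\ge0$ with $t_0+mh\le T$ the global error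 satisfies $E[(X(t_0+mh)-X_m)^2]^{1/2}\le C\,h$. (2) Suppose in addition that $a\,b=db/dt$ on $[t_0,T]$ (the exact differential case). Then $X(t)=b(t)W(t)$ is a solution of the SDE on $[t_0,T]$. If moreover the second derivative of $a$ is bounded on $[t_0,T]$, there is a constant $C$, depending only on $a,b,t_0,T,M$, such that for every solution $X$ as above: (i) for all $h>0$ and $m\ge0$ with $t_0+mh\le T$, $E[(X(t_0+mh)-X_m)^2]^{1/2}\le C\,h^2$; (ii) for all $t\ge t_0$, $h>0$ with $t+h\le T$ and every $k$, the local error $\epsilon$, that is, $X(t+h)$ minus the result of one step of the scheme with sign $S_k$ started from the exact value $X(t)$ at time $t$, is square integrable with $|E[\epsilon]|\le C\,h^3$ and $\operatorname{Var}[\epsilon]\le C\,h^5$. -/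

import Mathlib

open MeasureTheory ProbabilityTheory Filter Topology Set
open scoped NNReal ENNReal

noncomputable section

/-- One step of the Runge--Kutta like scheme for the scalar SDE `dX = a(t,X) dt + b(t,X) dW`,
from the value `x` at time `t`, with time step `h`, noise increment `dW` and sign `σ`. -/
def rkStep (a b : ℝ → ℝ → ℝ) (t h x dW σ : ℝ) : ℝ :=
  let K₁ := h * a t x + (dW - σ * √h) * b t x
  let K₂ := h * a (t + h) (x + K₁) + (dW + σ * √h) * b (t + h) (x + K₁)
  x + (K₁ + K₂) / 2

/-- The increment `W(t + h) - W(t)` of the noise. -/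
def noiseIncr {Ω : Type*} (W : ℝ≥0 → Ω → ℝ) (t h : ℝ) (ω : Ω) : ℝ :=
  W (t + h).toNNReal ω - W t.toNNReal ω

/-- The numerical solution: `rkScheme a b t₀ h W S ξ k` approximates the solution at time
`t₀ + k h`; it starts from `ξ`, and its `k`-th step uses the increment of `W` over
`[t₀ + k h, t₀ + (k + 1) h]` and the sign `S k`. -/
def rkScheme {Ω : Type*} (a b : ℝ → ℝ → ℝ) (t₀ h : ℝ) (W : ℝ≥0 → Ω → ℝ) (S : ℕ → Ω → ℝ)
    (ξ : Ω → ℝ) : ℕ → Ω → ℝ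
  | 0, ω => ξ ω
  | k + 1, ω =>
      rkStep a b (t₀ + k * h) h (rkScheme a b t₀ h W S ξ k ω) (noiseIncr W (t₀ + k * h) h ω)
        (S k ω)

/-- `W` is a Brownian motion (Wiener process) relative to the filtration `F`: a standard Brownian
motion, adapted to `F`, whose increments after time `s` are independent of `F s`. -/
structure IsFilteredBrownian {Ω : Type*} [mΩ : MeasurableSpace Ω] (P : Measure Ω)
    (F : Filtration ℝ≥0 mΩ) (W : ℝ≥0 → Ω → ℝ) : Prop where
  brownian : IsBrownianReal W P
  adapted : ∀ t, StronglyMeasurable[F t] (W t)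
  indep : ∀ s t, s ≤ t →
    Indep (MeasurableSpace.comap (fun ω => W t ω - W s ω) inferInstance) (F s) P

/-- The random signs of the scheme: independent, `±1` with probability `1/2` each, and chosen
independently of the filtration `F` that carries the initial value and the noise. -/
structure IsRandomSigns {Ω : Type*} [mΩ : MeasurableSpace Ω] (P : Measure Ω)
    (F : Filtration ℝ≥0 mΩ) (S : ℕ → Ω → ℝ) : Prop where
  measurable : ∀ k, Measurable (S k)
  prob_one : ∀ k, P {ω | S k ω = 1} = 1 / 2
  prob_neg_one : ∀ k, P {ω | S k ω = -1} = 1 / 2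
  iIndep : iIndepFun S P
  indep : Indep (⨆ k, MeasurableSpace.comap (S k) inferInstance) (⨆ t, F t) P

/-- A deterministic step function `∑ i, c i • 1_(u i, v i]` on the time axis. -/
structure TimeStep where
  n : ℕ
  c : Fin n → ℝ
  u : Fin n → ℝ≥0
  v : Fin n → ℝ≥0
  le : ∀ i, u i ≤ v i

/-- The function `∑ i, c i • 1_(u i, v i]`. -/
def TimeStep.eval (φ : TimeStep) (r : ℝ) : ℝ :=
  ∑ i, φ.c i * (Ioc (φ.u i : ℝ) (φ.v i : ℝ)).indicator (fun _ => (1 : ℝ)) r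

/-- The elementary stochastic integral `∑ i, c i (W (v i) - W (u i))`. -/
def TimeStep.integ {Ω : Type*} (φ : TimeStep) (W : ℝ≥0 → Ω → ℝ) (ω : Ω) : ℝ :=
  ∑ i, φ.c i * (W (φ.v i) ω - W (φ.u i) ω)

/-- `I` is (a version of) the Itô integral `∫_s^t f(r) dW_r` of the deterministic integrand `f`:
the limit in `L²(P)` of the elementary integrals of step functions on `(s, t]` that converge to `f`
in `L²(s, t)`. (By the Itô isometry the limit does not depend on the step functions.) -/
def IsItoIntegral {Ω : Type*} [MeasurableSpace Ω] (P : Measure Ω) (W : ℝ≥0 → Ω → ℝ)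
    (f : ℝ → ℝ) (s t : ℝ) (I : Ω → ℝ) : Prop :=
  ∃ φ : ℕ → TimeStep,
    (∀ n i, s ≤ (φ n).u i ∧ ((φ n).v i : ℝ) ≤ t) ∧
    Tendsto (fun n => eLpNorm (fun r => (φ n).eval r - f r) 2 (volume.restrict (Ioc s t)))
      atTop (𝓝 0) ∧
    Tendsto (fun n => eLpNorm (fun ω => (φ n).integ W ω - I ω) 2 P) atTop (𝓝 0)

/-- `X` solves the linear Itô SDE with additive noise `dX = a(t) X dt + b(t) dW` on `[t₀, T]`:
it is adapted, has almost surely continuous paths, and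
`X_t - X_{t₀} - ∫_{t₀}^t a(r) X_r dr = ∫_{t₀}^t b(r) dW_r` for all `t` in `[t₀, T]`. -/
structure IsLinearSDESolution {Ω : Type*} [mΩ : MeasurableSpace Ω] (P : Measure Ω)
    (F : Filtration ℝ≥0 mΩ) (W : ℝ≥0 → Ω → ℝ) (a b : ℝ → ℝ) (t₀ T : ℝ)
    (X : ℝ → Ω → ℝ) : Prop where
  adapted : ∀ t ∈ Icc t₀ T, StronglyMeasurable[F t.toNNReal] (X t)
  continuous : ∀ᵐ ω ∂P, ContinuousOn (fun t => X t ω) (Icc t₀ T)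
  integral_eq : ∀ t ∈ Icc t₀ T,
    IsItoIntegral P W b t₀ t (fun ω => X t ω - X t₀ ω - ∫ r in t₀..t, a r * X r ω)

/-- `f` is twice differentiable on `[t₀, T]` (one-sidedly at the end points). -/
def TwiceDifferentiableOn (f : ℝ → ℝ) (t₀ T : ℝ) : Prop :=
  DifferentiableOn ℝ f (Icc t₀ T) ∧ DifferentiableOn ℝ (derivWithin f (Icc t₀ T)) (Icc t₀ T)

/-- The error `X(t₀ + m h) - X_m` after `m` steps of the scheme, started from `X(t₀)` and applied
to `dX = a(t) X dt + b(t) dW`. -/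
def globalError {Ω : Type*} (a b : ℝ → ℝ) (W : ℝ≥0 → Ω → ℝ) (S : ℕ → Ω → ℝ) (X : ℝ → Ω → ℝ)
    (t₀ h : ℝ) (m : ℕ) (ω : Ω) : ℝ :=
  X (t₀ + m * h) ω - rkScheme (fun t x => a t * x) (fun t _ => b t) t₀ h W S (X t₀) m ω

/-- The error `X(t + h) - X̂` of one step of the scheme with sign `σ`, where the step starts from
the exact value `X(t)`, applied to `dX = a(t) X dt + b(t) dW`. -/
def localError {Ω : Type*} (a b : ℝ → ℝ) (W : ℝ≥0 → Ω → ℝ) (σ : Ω → ℝ) (X : ℝ → Ω → ℝ)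
    (t h : ℝ) (ω : Ω) : ℝ :=
  X (t + h) ω -
    rkStep (fun t x => a t * x) (fun t _ => b t) t h (X t ω) (noiseIncr W t h ω) (σ ω)

end

/-! The noise is additive, so variation of constants with a primitive `A` of `a` solves the equation
path by path: X(t+h) is exp(A(t+h) - A(t)) X(t), plus b(t+h) ΔW, plus the integral over [t, t+h] of
exp(A(t+h) - A(r)) (ab - b')(r) (W(r) - W(t)). One step of the scheme is affine in x, ΔW and S.
Subtracting, the global error satisfies e_{k+1} = G_k e_k + D_k X(t_k) + N_k - ν_k √h S_k, where D
is `driftDefect`, N is `stepNoise`, ν is `noiseDefect` and |G_k| ≤ exp(Kh), so that products of the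
G_k stay bounded.

By linearity the three sources can be treated separately. The drift terms have size h^(p+1), and at
most (T - t₀)/h of them add up to h^p by the triangle inequality (`rmsLe_affineRec`). The noise and
sign terms have size h^p √h; each family is pairwise orthogonal in L², so m of them add up only like
√m, which is again h^p (`rmsLe_affineRec_of_orthogonal`). In general p = 1. If ab = b', the integral
disappears and ν is O(h²); a Lipschitz a' makes D of size h³; hence p = 2. `exists_rk_error_bound`
treats both cases at once.

The analytic point is to turn the Itô integral of b into an ordinary one. The isometry for step
functions makes the L² limit unique (`IsItoIntegral.ae_eq`), and integration by parts exhibits one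
version of it (`isItoIntegral_by_parts`). Then X - bW almost surely has C¹ paths, and ordinary
calculus gives the formula. Of the law of W only means and covariances enter. -/

/-- `f` is square integrable with root mean square at most `c`. -/
def RmsLe {Ω : Type*} [MeasurableSpace Ω] (P : Measure Ω) (f : Ω → ℝ) (c : ℝ) : Prop :=
  MemLp f 2 P ∧ 0 ≤ c ∧ ∫ ω, f ω ^ 2 ∂P ≤ c ^ 2

/-! ### Root mean square bounds, and Fubini for integrals over time -/

section L2

variable {Ω : Type*} [MeasurableSpace Ω] {P : Measure Ω}

theorem eLpNorm_two_eq_sqrt_integral {f : Ω → ℝ} (hf : MemLp f 2 P) :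
    eLpNorm f 2 P = ENNReal.ofReal √(∫ ω, f ω ^ 2 ∂P) := by
  rw [hf.eLpNorm_eq_integral_rpow_norm (by norm_num) (by norm_num), Real.sqrt_eq_rpow]
  norm_num

theorem rmsLe_iff {f : Ω → ℝ} {c : ℝ} (hf : MemLp f 2 P) (hc : 0 ≤ c) :
    RmsLe P f c ↔ eLpNorm f 2 P ≤ ENNReal.ofReal c := by
  rw [eLpNorm_two_eq_sqrt_integral hf, ENNReal.ofReal_le_ofReal_iff hc, Real.sqrt_le_left hc]
  exact ⟨fun h => h.2.2, fun h => ⟨hf, hc, h⟩⟩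

theorem RmsLe.eLpNorm_le {f : Ω → ℝ} {c : ℝ} (h : RmsLe P f c) :
    eLpNorm f 2 P ≤ ENNReal.ofReal c :=
  (rmsLe_iff h.1 h.2.1).1 h

theorem RmsLe.add {f g : Ω → ℝ} {c d : ℝ} (hf : RmsLe P f c) (hg : RmsLe P g d) :
    RmsLe P (fun ω => f ω + g ω) (c + d) := by
  refine (rmsLe_iff (hf.1.add hg.1) (add_nonneg hf.2.1 hg.2.1)).2 ?_
  rw [ENNReal.ofReal_add hf.2.1 hg.2.1]
  exact (eLpNorm_add_le hf.1.1 hg.1.1 (by norm_num)).trans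
    (add_le_add hf.eLpNorm_le hg.eLpNorm_le)

theorem RmsLe.const_mul {f : Ω → ℝ} {c : ℝ} (hf : RmsLe P f c) (x : ℝ) :
    RmsLe P (fun ω => x * f ω) (|x| * c) := by
  refine ⟨hf.1.const_mul x, mul_nonneg (abs_nonneg x) hf.2.1, ?_⟩
  simp_rw [mul_pow, integral_const_mul, sq_abs]
  exact mul_le_mul_of_nonneg_left hf.2.2 (sq_nonneg x)

theorem RmsLe.mono {f : Ω → ℝ} {c d : ℝ} (hf : RmsLe P f c) (h : c ≤ d) : RmsLe P f d :=
  ⟨hf.1, hf.2.1.trans h, hf.2.2.trans (pow_le_pow_left₀ hf.2.1 h 2)⟩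

theorem RmsLe.congr {f g : Ω → ℝ} {c : ℝ} (hf : RmsLe P f c) (h : f =ᵐ[P] g) : RmsLe P g c := by
  refine ⟨hf.1.ae_eq h, hf.2.1, ?_⟩
  rw [← integral_congr_ae (h.mono fun ω hω => congrArg (· ^ 2) hω)]
  exact hf.2.2

theorem rmsLe_zero {c : ℝ} (hc : 0 ≤ c) : RmsLe P (fun _ => (0 : ℝ)) c :=
  ⟨MemLp.zero, hc, by simpa using sq_nonneg c⟩

theorem rmsLe_sum {f : ℕ → Ω → ℝ} {c : ℝ} {n : ℕ} (h : ∀ i < n, RmsLe P (f i) c) :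
    RmsLe P (fun ω => ∑ i ∈ Finset.range n, f i ω) (n * c) := by
  induction n with
  | zero => simpa using rmsLe_zero (P := P) le_rfl
  | succ n ih =>
    simp_rw [Finset.sum_range_succ]
    have := (ih fun i hi => h i (hi.trans n.lt_succ_self)).add (h n n.lt_succ_self)
    refine this.mono (le_of_eq ?_)
    push_cast; ring

theorem RmsLe.abs_integral_le [IsProbabilityMeasure P] {f : Ω → ℝ} {c : ℝ} (hf : RmsLe P f c) :
    |∫ ω, f ω ∂P| ≤ c := by
  have h := variance_nonneg f P
  rw [variance_eq_sub hf.1] at h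
  have h2 := hf.2.2
  refine abs_le_of_sq_le_sq ?_ hf.2.1
  simp only [Pi.pow_apply] at h
  linarith

/-- Cauchy–Schwarz against the constant 1, read off from the nonnegative integral of ((t - s) f - ∫
f)². -/
theorem sq_setIntegral_le {f : ℝ → ℝ} {s t : ℝ} (hst : s ≤ t)
    (hf : MemLp f 2 (volume.restrict (Ioc s t))) :
    (∫ r in Ioc s t, f r) ^ 2 ≤ (t - s) * ∫ r in Ioc s t, f r ^ 2 := by
  rcases hst.eq_or_lt with rfl | hlt
  · simp
  have hi : Integrable f (volume.restrict (Ioc s t)) := hf.integrable (by norm_num)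
  have hsq := hf.integrable_sq
  set I := ∫ r in Ioc s t, f r with hI
  set J := ∫ r in Ioc s t, f r ^ 2 with hJ
  have h0 : 0 ≤ ∫ r in Ioc s t, ((t - s) * f r - I) ^ 2 := integral_nonneg fun r => sq_nonneg _
  have h1 : ∫ r in Ioc s t, ((t - s) * f r - I) ^ 2 =
      (t - s) ^ 2 * J - 2 * (t - s) * I * I + (t - s) * I ^ 2 := by
    have : ∀ r, ((t - s) * f r - I) ^ 2 =
      (t - s) ^ 2 * f r ^ 2 - 2 * (t - s) * I * f r + I ^ 2 := fun r => by ring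
    simp_rw [this]
    rw [integral_add (f := fun r => (t - s) ^ 2 * f r ^ 2 - 2 * (t - s) * I * f r)
        ((hsq.const_mul _).sub (hi.const_mul _)) (integrable_const _),
      integral_sub (hsq.const_mul _) (hi.const_mul _), integral_const_mul, integral_const_mul]
    simp [hlt.le, hI, hJ]
  rw [h1] at h0
  have hpos : 0 < t - s := sub_pos.2 hlt
  nlinarith

/-- Uniform second moments give square integrability on the product space, which is what licenses
the exchanges of integrals below. -/
theorem memLp_two_uncurry [IsProbabilityMeasure P] {Z : ℝ → Ω → ℝ} {s t K : ℝ}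
    (hZ : AEStronglyMeasurable (Function.uncurry Z) ((volume.restrict (Ioc s t)).prod P))
    (hK : ∀ r ∈ Ioc s t, RmsLe P (Z r) K) :
    MemLp (Function.uncurry Z) 2 ((volume.restrict (Ioc s t)).prod P) := by
  rw [memLp_two_iff_integrable_sq hZ]
  refine (integrable_prod_iff (hZ.pow 2)).2 ⟨?_, ?_⟩
  · exact (ae_restrict_iff' measurableSet_Ioc).2 (ae_of_all _ fun r hr => (hK r hr).1.integrable_sq)
  · refine Integrable.of_bound (hZ.pow 2).norm.integral_prod_right' (K ^ 2) ?_
    refine (ae_restrict_iff' measurableSet_Ioc).2 (ae_of_all _ fun r hr => ?_)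
    have : ∀ ω, ‖Function.uncurry Z (r, ω) ^ 2‖ = Z r ω ^ 2 := fun ω => by
      simp [Function.uncurry]
    simp only [Pi.pow_apply, this]
    rw [Real.norm_of_nonneg (integral_nonneg fun _ => sq_nonneg _)]
    exact (hK r hr).2.2

/-- Minkowski's integral inequality for a uniform bound: Cauchy–Schwarz along each path, then
Fubini. -/
theorem rmsLe_intervalIntegral [IsProbabilityMeasure P] {Z : ℝ → Ω → ℝ} {s t K : ℝ} (hst : s ≤ t)
    (hK0 : 0 ≤ K)
    (hZ : AEStronglyMeasurable (Function.uncurry Z) ((volume.restrict (Ioc s t)).prod P))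
    (hK : ∀ r ∈ Ioc s t, RmsLe P (Z r) K) :
    RmsLe P (fun ω => ∫ r in s..t, Z r ω) ((t - s) * K) := by
  have hL := memLp_two_uncurry hZ hK
  have hsq := hL.integrable_sq
  have hmeas : AEStronglyMeasurable (fun ω => ∫ r in Ioc s t, Z r ω) P :=
    hZ.prod_swap.integral_prod_right'
  have hmaj := hsq.swap.integral_prod_left.const_mul (t - s)
  have hle : ∀ᵐ ω ∂P, (∫ r in Ioc s t, Z r ω) ^ 2 ≤ (t - s) * ∫ r in Ioc s t, Z r ω ^ 2 := by
    filter_upwards [hsq.swap.prod_right_ae, hZ.prod_swap.prodMk_left] with ω h1 h2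
    exact sq_setIntegral_le hst ((memLp_two_iff_integrable_sq h2).2 h1)
  have hi : Integrable (fun ω => (∫ r in Ioc s t, Z r ω) ^ 2) P := by
    refine hmaj.mono' (hmeas.pow 2) ?_
    filter_upwards [hle] with ω h
    rw [Real.norm_of_nonneg (sq_nonneg _)]
    exact h
  simp_rw [intervalIntegral.integral_of_le hst]
  refine ⟨(memLp_two_iff_integrable_sq hmeas).2 hi, mul_nonneg (sub_nonneg.2 hst) hK0, ?_⟩
  calc ∫ ω, (∫ r in Ioc s t, Z r ω) ^ 2 ∂P
      ≤ ∫ ω, (t - s) * (∫ r in Ioc s t, Z r ω ^ 2) ∂P := integral_mono_ae hi hmaj hle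
    _ = (t - s) * ∫ r in Ioc s t, (∫ ω, Z r ω ^ 2 ∂P) := by
        rw [integral_const_mul, integral_integral_swap (f := fun ω r => Z r ω ^ 2) hsq.swap]
    _ ≤ (t - s) * ∫ r in Ioc s t, K ^ 2 := by
        refine mul_le_mul_of_nonneg_left ?_ (sub_nonneg.2 hst)
        refine setIntegral_mono_on hsq.integral_prod_left (integrable_const _)
          measurableSet_Ioc fun r hr => (hK r hr).2.2
    _ = ((t - s) * K) ^ 2 := by simp [hst]; ring

theorem integral_intervalIntegral_mul_eq_zero [IsProbabilityMeasure P] {Z : ℝ → Ω → ℝ}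
    {Y : Ω → ℝ} {s t K : ℝ} (hst : s ≤ t) (hY : MemLp Y 2 P)
    (hZ : AEStronglyMeasurable (Function.uncurry Z) ((volume.restrict (Ioc s t)).prod P))
    (hK : ∀ r ∈ Ioc s t, RmsLe P (Z r) K)
    (h0 : ∀ r ∈ Ioc s t, ∫ ω, Z r ω * Y ω ∂P = 0) :
    ∫ ω, (∫ r in s..t, Z r ω) * Y ω ∂P = 0 := by
  have hint := (memLp_two_uncurry hZ hK).integrable_mul
    (hY.comp_snd (volume.restrict (Ioc s t)))
  simp_rw [intervalIntegral.integral_of_le hst, ← integral_mul_const]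
  rw [integral_integral_swap (f := fun ω r => Z r ω * Y ω) hint.swap]
  rw [setIntegral_congr_fun measurableSet_Ioc h0]
  simp

end L2

/-! ### Continuous modifications and second moments of Brownian motion -/

theorem exists_continuous_modification {Ω : Type*} [MeasurableSpace Ω] {P : Measure Ω}
    {Z : ℝ → Ω → ℝ} {t₀ T : ℝ} (hT : t₀ ≤ T) (hm : ∀ t ∈ Icc t₀ T, Measurable (Z t))
    (hc : ∀ᵐ ω ∂P, ContinuousOn (fun t => Z t ω) (Icc t₀ T)) :
    ∃ Z' : ℝ → Ω → ℝ, Measurable (Function.uncurry Z') ∧ (∀ ω, Continuous fun t => Z' t ω) ∧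
      ∀ᵐ ω ∂P, ∀ t ∈ Icc t₀ T, Z' t ω = Z t ω := by
  obtain ⟨N, hN, hNm, hN0⟩ := exists_measurable_superset_of_null (ae_iff.1 hc)
  have hcN : ∀ ω, ω ∉ N → ContinuousOn (fun t => Z t ω) (Icc t₀ T) := fun ω hω => by
    by_contra h
    exact hω (hN h)
  have hcont : ∀ ω, Continuous fun t => Nᶜ.indicator (Z (projIcc t₀ T hT t)) ω := fun ω => by
    by_cases hω : ω ∈ N
    · simpa [hω] using continuous_const
    · simpa [hω, Function.comp_def] using (hcN ω hω).comp_continuous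
        (continuous_subtype_val.comp (continuous_projIcc (h := hT))) fun t => (projIcc t₀ T hT t).2
  -- Paths in the null set are replaced by 0 and all others are frozen outside [t₀, T]. Every path
  -- is then continuous on the whole line, which yields joint measurability.
  refine ⟨fun t => Nᶜ.indicator (Z (projIcc t₀ T hT t)), ?_, hcont, ?_⟩
  · exact measurable_uncurry_of_continuous_of_measurable hcont fun t =>
      (hm _ (projIcc t₀ T hT t).2).indicator hNm.compl
  · filter_upwards [measure_eq_zero_iff_ae_notMem.1 hN0] with ω hω t ht
    simp [hω, projIcc_of_mem hT ht]

/-- `w` has everywhere continuous paths and, on `[t₀, T]`, the means and covariances of a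
Brownian motion. -/
structure IsContBrownian {Ω : Type*} [MeasurableSpace Ω] (P : Measure Ω) (w : ℝ → Ω → ℝ)
    (t₀ T : ℝ) : Prop where
  measurable_uncurry : Measurable (Function.uncurry w)
  continuous : ∀ ω, Continuous fun t => w t ω
  memLp : ∀ t ∈ Icc t₀ T, MemLp (w t) 2 P
  integral_eq_zero : ∀ t ∈ Icc t₀ T, ∫ ω, w t ω ∂P = 0
  integral_mul : ∀ s ∈ Icc t₀ T, ∀ t ∈ Icc t₀ T, ∫ ω, w s ω * w t ω ∂P = min s t

theorem IsFilteredBrownian.exists_isContBrownian {Ω : Type*} [mΩ : MeasurableSpace Ω]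
    {P : Measure Ω} [IsProbabilityMeasure P] {F : Filtration ℝ≥0 mΩ} {W : ℝ≥0 → Ω → ℝ}
    (hW : IsFilteredBrownian P F W) {t₀ T : ℝ} (ht₀ : 0 ≤ t₀) (hT : t₀ ≤ T) :
    ∃ w : ℝ → Ω → ℝ, IsContBrownian P w t₀ T ∧
      ∀ᵐ ω ∂P, ∀ t ∈ Icc t₀ T, w t ω = W t.toNNReal ω := by
  obtain ⟨w, hwm, hwc, hw⟩ := exists_continuous_modification (P := P)
    (Z := fun t ω => W t.toNNReal ω) hT
    (fun t _ => ((hW.adapted _).mono (F.le _)).measurable)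
    (hW.brownian.cont.mono fun ω hω => (hω.comp continuous_real_toNNReal).continuousOn)
  have hae : ∀ t ∈ Icc t₀ T, w t =ᵐ[P] W t.toNNReal := fun t ht => hw.mono fun ω h => h t ht
  have hL : ∀ t, MemLp (W t) 2 P := fun t =>
    (hW.brownian.isGaussianProcess.hasGaussianLaw_eval t).memLp_two
  refine ⟨w, ⟨hwm, hwc, fun t ht => (memLp_congr_ae (hae t ht)).2 (hL _), fun t ht => ?_,
    fun s hs t ht => ?_⟩, hw⟩
  · rw [integral_congr_ae (hae t ht)]
    exact hW.brownian.integral_eval _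
  · rw [integral_congr_ae (f := fun ω => w s ω * w t ω) (g := fun ω => W s.toNNReal ω * W t.toNNReal ω)
      ((hae s hs).mul (hae t ht))]
    have h := hW.brownian.covariance_eval s.toNNReal t.toNNReal
    rw [covariance_eq_sub (hL _) (hL _), hW.brownian.integral_eval, zero_mul, sub_zero] at h
    simp only [Pi.mul_apply] at h
    rw [h]
    simp [ht₀.trans hs.1, ht₀.trans ht.1]

namespace IsContBrownian

variable {Ω : Type*} [MeasurableSpace Ω] {P : Measure Ω} {w : ℝ → Ω → ℝ} {t₀ T : ℝ}

theorem memLp_sub (hw : IsContBrownian P w t₀ T) {u v : ℝ} (hu : u ∈ Icc t₀ T)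
    (hv : v ∈ Icc t₀ T) : MemLp (fun ω => w v ω - w u ω) 2 P :=
  (hw.memLp v hv).sub (hw.memLp u hu)

theorem integral_sub_mul_sub (hw : IsContBrownian P w t₀ T) {u v u' v' : ℝ} (hu : u ∈ Icc t₀ T)
    (hv : v ∈ Icc t₀ T) (hu' : u' ∈ Icc t₀ T) (hv' : v' ∈ Icc t₀ T) :
    ∫ ω, (w v ω - w u ω) * (w v' ω - w u' ω) ∂P =
      min v v' - min v u' - (min u v' - min u u') := by
  have hi : ∀ s ∈ Icc t₀ T, ∀ t ∈ Icc t₀ T, Integrable (fun ω => w s ω * w t ω) P :=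
    fun s hs t ht => (hw.memLp s hs).integrable_mul (hw.memLp t ht)
  simp_rw [sub_mul, mul_sub]
  rw [integral_sub (f := fun ω => w v ω * w v' ω - w v ω * w u' ω)
    (g := fun ω => w u ω * w v' ω - w u ω * w u' ω) ((hi v hv v' hv').sub (hi v hv u' hu'))
    ((hi u hu v' hv').sub (hi u hu u' hu')), integral_sub (hi v hv v' hv') (hi v hv u' hu'),
    integral_sub (hi u hu v' hv') (hi u hu u' hu')]
  simp_rw [hw.integral_mul v hv v' hv', hw.integral_mul v hv u' hu', hw.integral_mul u hu v' hv',
    hw.integral_mul u hu u' hu']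

theorem integral_sub_mul_sub_eq_zero (hw : IsContBrownian P w t₀ T) {u v u' v' : ℝ}
    (hu : u ∈ Icc t₀ T) (hv : v ∈ Icc t₀ T) (hu' : u' ∈ Icc t₀ T) (hv' : v' ∈ Icc t₀ T)
    (h1 : u ≤ v) (h2 : v ≤ u') (h3 : u' ≤ v') :
    ∫ ω, (w v' ω - w u' ω) * (w v ω - w u ω) ∂P = 0 := by
  rw [hw.integral_sub_mul_sub hu' hv' hu hv, min_eq_right (h2.trans h3),
    min_eq_right (h1.trans (h2.trans h3)), min_eq_right h2, min_eq_right (h1.trans h2)]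
  ring

theorem rmsLe_sub (hw : IsContBrownian P w t₀ T) {u v h : ℝ} (hu : u ∈ Icc t₀ T)
    (hv : v ∈ Icc t₀ T) (h1 : |v - u| ≤ h) : RmsLe P (fun ω => w v ω - w u ω) √h := by
  have h0 : 0 ≤ h := (abs_nonneg _).trans h1
  refine ⟨hw.memLp_sub hu hv, Real.sqrt_nonneg _, ?_⟩
  simp_rw [pow_two (w v _ - w u _)]
  rw [hw.integral_sub_mul_sub hu hv hu hv, Real.sq_sqrt h0]
  refine le_trans (le_of_eq ?_) h1
  rw [min_self, min_self, min_comm u v, ← max_sub_min_eq_abs]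
  linarith [min_add_max v u, max_comm u v, min_comm u v]

theorem aestronglyMeasurable_mul_sub (hw : IsContBrownian P w t₀ T) {g : ℝ → ℝ} {s t : ℝ}
    (hg : ContinuousOn g (Icc s t)) (c : ℝ) [IsProbabilityMeasure P] :
    AEStronglyMeasurable (Function.uncurry fun r ω => g r * (w r ω - w c ω))
      ((volume.restrict (Ioc s t)).prod P) := by
  have h1 : AEStronglyMeasurable g (volume.restrict (Ioc s t)) :=
    (hg.mono Ioc_subset_Icc_self).aestronglyMeasurable measurableSet_Ioc
  have h2 : Measurable fun x : ℝ × Ω => w x.1 x.2 - w c x.2 :=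
    hw.measurable_uncurry.sub (hw.measurable_uncurry.comp (measurable_const.prodMk measurable_snd))
  exact h1.comp_fst.mul h2.aestronglyMeasurable

theorem rmsLe_mul_sub (hw : IsContBrownian P w t₀ T) {g : ℝ → ℝ} {s t c B : ℝ} (hs : t₀ ≤ s)
    (ht : t ≤ T) (hc : c ∈ Icc s t) (hB : ∀ r ∈ Icc s t, |g r| ≤ B) {r : ℝ} (hr : r ∈ Ioc s t) :
    RmsLe P (fun ω => g r * (w r ω - w c ω)) (B * √(t - s)) := by
  have h : |r - c| ≤ t - s := abs_sub_le_iff.2 ⟨by linarith [hr.2, hc.1], by linarith [hr.1, hc.2]⟩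
  exact ((hw.rmsLe_sub (u := c) (v := r) ⟨by linarith [hc.1], by linarith [hc.2]⟩
    ⟨by linarith [hr.1], by linarith [hr.2]⟩ h).const_mul (g r)).mono
    (mul_le_mul_of_nonneg_right (hB r (Ioc_subset_Icc_self hr)) (Real.sqrt_nonneg _))

theorem rmsLe_integral_mul_sub (hw : IsContBrownian P w t₀ T) [IsProbabilityMeasure P]
    {g : ℝ → ℝ} {s t c B : ℝ} (hs : t₀ ≤ s) (ht : t ≤ T) (hg : ContinuousOn g (Icc s t))
    (hc : c ∈ Icc s t) (hB : ∀ r ∈ Icc s t, |g r| ≤ B) :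
    RmsLe P (fun ω => ∫ r in s..t, g r * (w r ω - w c ω)) ((t - s) * (B * √(t - s))) :=
  rmsLe_intervalIntegral (hc.1.trans hc.2)
    (mul_nonneg ((abs_nonneg _).trans (hB c hc)) (Real.sqrt_nonneg _))
    (hw.aestronglyMeasurable_mul_sub hg c) fun _ hr => hw.rmsLe_mul_sub hs ht hc hB hr

/-- Orthogonality to `Y` passes from the single increments to their weighted time integral by
Fubini. -/
theorem integral_integral_mul_sub_mul_eq_zero (hw : IsContBrownian P w t₀ T)
    [IsProbabilityMeasure P] {g : ℝ → ℝ} {s t c : ℝ} {Y : Ω → ℝ} (hs : t₀ ≤ s) (ht : t ≤ T)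
    (hg : ContinuousOn g (Icc s t)) (hc : c ∈ Icc s t) (hY : MemLp Y 2 P)
    (h0 : ∀ r ∈ Icc s t, ∫ ω, (w r ω - w c ω) * Y ω ∂P = 0) :
    ∫ ω, (∫ r in s..t, g r * (w r ω - w c ω)) * Y ω ∂P = 0 := by
  obtain ⟨B, hB⟩ := isCompact_Icc.exists_bound_of_continuousOn hg
  refine integral_intervalIntegral_mul_eq_zero (hc.1.trans hc.2) hY
    (hw.aestronglyMeasurable_mul_sub hg c) (fun _ hr => hw.rmsLe_mul_sub hs ht hc hB hr)
    fun r hr => ?_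
  simp_rw [mul_assoc]
  rw [integral_const_mul, h0 r (Ioc_subset_Icc_self hr), mul_zero]

end IsContBrownian

/-! ### The Itô isometry for step functions -/

theorem min_sub_min_eq_max_min_sub_max {u v u' v' : ℝ} (h : u ≤ v) (h' : u' ≤ v') :
    min v v' - min v u' - (min u v' - min u u') = max (min v v' - max u u') 0 := by
  rcases le_total v v' with h1 | h1 <;> rcases le_total v u' with h2 | h2 <;>
    rcases le_total u v' with h3 | h3 <;> rcases le_total u u' with h4 | h4 <;>
    simp only [min_eq_left, min_eq_right, max_eq_left, max_eq_right, h1, h2, h3, h4] <;>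
    first
    | rw [max_eq_left (by linarith)]; linarith
    | rw [max_eq_right (by linarith)]; linarith

theorem integral_sq_sum {α ι : Type*} [MeasurableSpace α] {μ : Measure α} [Fintype ι]
    {f : ι → α → ℝ} (c : ι → ℝ) (hf : ∀ i, MemLp (f i) 2 μ) :
    ∫ x, (∑ i, c i * f i x) ^ 2 ∂μ = ∑ i, ∑ j, c i * c j * ∫ x, f i x * f j x ∂μ := by
  have hi : ∀ i j, Integrable (fun x => c i * c j * (f i x * f j x)) μ := fun i j =>
    ((hf i).integrable_mul (hf j)).const_mul _
  have : ∀ x, (∑ i, c i * f i x) ^ 2 = ∑ i, ∑ j, c i * c j * (f i x * f j x) := fun x => by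
    rw [pow_two, Finset.sum_mul_sum]
    exact Finset.sum_congr rfl fun i _ => Finset.sum_congr rfl fun j _ => by ring
  simp_rw [this]
  rw [integral_finsetSum _ fun i _ => integrable_finsetSum _ fun j _ => hi i j]
  refine Finset.sum_congr rfl fun i _ => ?_
  rw [integral_finsetSum _ fun j _ => hi i j]
  simp_rw [integral_const_mul]

namespace IsContBrownian

variable {Ω : Type*} [MeasurableSpace Ω] {P : Measure Ω} {w : ℝ → Ω → ℝ} {t₀ T : ℝ}

/-- The Itô isometry for step functions. -/
theorem eLpNorm_sum_eq (hw : IsContBrownian P w t₀ T) {ι : Type*} [Fintype ι] (c : ι → ℝ)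
    {u v : ι → ℝ} {s t : ℝ} (hs : t₀ ≤ s) (ht : t ≤ T) (hsu : ∀ i, s ≤ u i)
    (huv : ∀ i, u i ≤ v i) (hvt : ∀ i, v i ≤ t) :
    eLpNorm (fun ω => ∑ i, c i * (w (v i) ω - w (u i) ω)) 2 P =
      eLpNorm (fun r => ∑ i, c i * (Ioc (u i) (v i)).indicator (fun _ => (1 : ℝ)) r) 2
        (volume.restrict (Ioc s t)) := by
  have hu : ∀ i, u i ∈ Icc t₀ T := fun i =>
    ⟨hs.trans (hsu i), (huv i).trans ((hvt i).trans ht)⟩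
  have hv : ∀ i, v i ∈ Icc t₀ T := fun i =>
    ⟨hs.trans ((hsu i).trans (huv i)), (hvt i).trans ht⟩
  have h1 : ∀ i, MemLp (fun ω => w (v i) ω - w (u i) ω) 2 P := fun i => hw.memLp_sub (hu i) (hv i)
  have h2 : ∀ i, MemLp ((Ioc (u i) (v i)).indicator fun _ => (1 : ℝ)) 2
      (volume.restrict (Ioc s t)) := fun i => (memLp_const 1).indicator measurableSet_Ioc
  rw [eLpNorm_two_eq_sqrt_integral (memLp_finsetSum _ fun i _ => (h1 i).const_mul (c i)),
    eLpNorm_two_eq_sqrt_integral (memLp_finsetSum _ fun i _ => (h2 i).const_mul (c i)),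
    integral_sq_sum c h1, integral_sq_sum c h2]
  congr 2
  refine Finset.sum_congr rfl fun i _ => Finset.sum_congr rfl fun j _ => ?_
  congr 1
  -- The covariance of two increments is the length of the overlap of their intervals, and so is the
  -- L² product of the two indicators.
  rw [hw.integral_sub_mul_sub (hu i) (hv i) (hu j) (hv j),
    min_sub_min_eq_max_min_sub_max (huv i) (huv j)]
  have : ∀ r, (Ioc (u i) (v i)).indicator (fun _ => (1 : ℝ)) r *
      (Ioc (u j) (v j)).indicator (fun _ => (1 : ℝ)) r =
      (Ioc (max (u i) (u j)) (min (v i) (v j))).indicator (fun _ => (1 : ℝ)) r := fun r => by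
    rw [← Set.inter_indicator_mul, Ioc_inter_Ioc]
    simp [max_def, min_def]
  simp_rw [this]
  rw [integral_indicator measurableSet_Ioc, Measure.restrict_restrict measurableSet_Ioc,
    Ioc_inter_Ioc, sup_eq_left.2 ((hsu i).trans (le_max_left _ _)),
    inf_eq_left.2 ((min_le_left _ _).trans (hvt i))]
  simp [Measure.real, ENNReal.toReal_ofReal']

end IsContBrownian

/-! ### The Itô integral of a deterministic integrand: uniqueness and integration by parts -/

section Ito

variable {Ω : Type*} [MeasurableSpace Ω] {P : Measure Ω} {w : ℝ → Ω → ℝ} {W : ℝ≥0 → Ω → ℝ}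
  {t₀ T : ℝ}

theorem TimeStep.integ_ae_eq (φ : TimeStep)
    (hwW : ∀ᵐ ω ∂P, ∀ t ∈ Icc t₀ T, w t ω = W t.toNNReal ω) {s t : ℝ} (hs : t₀ ≤ s) (ht : t ≤ T)
    (hφ : ∀ i, s ≤ φ.u i ∧ (φ.v i : ℝ) ≤ t) :
    φ.integ W =ᵐ[P] fun ω => ∑ i, φ.c i * (w (φ.v i) ω - w (φ.u i) ω) := by
  filter_upwards [hwW] with ω hω
  refine Finset.sum_congr rfl fun i _ => ?_
  have h : (φ.u i : ℝ) ≤ φ.v i := NNReal.coe_le_coe.2 (φ.le i)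
  rw [hω (φ.v i) ⟨by linarith [(hφ i).1], by linarith [(hφ i).2]⟩,
    hω (φ.u i) ⟨by linarith [(hφ i).1], by linarith [(hφ i).2]⟩]
  simp

theorem TimeStep.measurable_eval (φ : TimeStep) : Measurable φ.eval :=
  Finset.measurable_sum _ fun _ _ =>
    (measurable_const.indicator measurableSet_Ioc).const_mul _

theorem TimeStep.eLpNorm_integ_sub (hw : IsContBrownian P w t₀ T)
    (hwW : ∀ᵐ ω ∂P, ∀ t ∈ Icc t₀ T, w t ω = W t.toNNReal ω) {s t : ℝ} (hs : t₀ ≤ s) (ht : t ≤ T)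
    {φ ψ : TimeStep} (hφ : ∀ i, s ≤ φ.u i ∧ (φ.v i : ℝ) ≤ t)
    (hψ : ∀ i, s ≤ ψ.u i ∧ (ψ.v i : ℝ) ≤ t) :
    eLpNorm (fun ω => φ.integ W ω - ψ.integ W ω) 2 P =
      eLpNorm (fun r => φ.eval r - ψ.eval r) 2 (volume.restrict (Ioc s t)) := by
  -- The difference of two step functions is a single one, indexed by the disjoint union, with the
  -- second family of coefficients negated.
  have h := hw.eLpNorm_sum_eq (Sum.elim φ.c fun i => -ψ.c i)
    (u := Sum.elim (fun i => (φ.u i : ℝ)) fun i => (ψ.u i : ℝ))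
    (v := Sum.elim (fun i => (φ.v i : ℝ)) fun i => (ψ.v i : ℝ)) hs ht
    (by rintro (i | i); exacts [(hφ i).1, (hψ i).1])
    (by rintro (i | i); exacts [φ.le i, ψ.le i])
    (by rintro (i | i); exacts [(hφ i).2, (hψ i).2])
  simp only [Fintype.sum_sum_type, Sum.elim_inl, Sum.elim_inr, neg_mul, Finset.sum_neg_distrib,
    ← sub_eq_add_neg] at h
  exact (eLpNorm_congr_ae ((φ.integ_ae_eq hwW hs ht hφ).sub (ψ.integ_ae_eq hwW hs ht hψ))).trans h

theorem TimeStep.aestronglyMeasurable_integ (hw : IsContBrownian P w t₀ T)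
    (hwW : ∀ᵐ ω ∂P, ∀ t ∈ Icc t₀ T, w t ω = W t.toNNReal ω) {s t : ℝ} (hs : t₀ ≤ s) (ht : t ≤ T)
    {φ : TimeStep} (hφ : ∀ i, s ≤ φ.u i ∧ (φ.v i : ℝ) ≤ t) :
    AEStronglyMeasurable (φ.integ W) P := by
  refine AEStronglyMeasurable.congr ?_ (φ.integ_ae_eq hwW hs ht hφ).symm
  have h : ∀ t, Measurable (w t) := fun t => hw.measurable_uncurry.of_uncurry_left
  exact (Finset.measurable_sum _ fun i _ =>
    ((h _).sub (h _)).const_mul _).aestronglyMeasurable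

/-- The Itô integral of a deterministic integrand is almost surely unique. -/
theorem IsItoIntegral.ae_eq (hw : IsContBrownian P w t₀ T)
    (hwW : ∀ᵐ ω ∂P, ∀ t ∈ Icc t₀ T, w t ω = W t.toNNReal ω) {s t : ℝ} (hs : t₀ ≤ s) (ht : t ≤ T)
    {f : ℝ → ℝ} (hf : AEStronglyMeasurable f (volume.restrict (Ioc s t))) {I J : Ω → ℝ}
    (hIm : AEStronglyMeasurable I P) (hJm : AEStronglyMeasurable J P)
    (hI : IsItoIntegral P W f s t I) (hJ : IsItoIntegral P W f s t J) : I =ᵐ[P] J := by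
  obtain ⟨φ, hφ, hφf, hφI⟩ := hI
  obtain ⟨ψ, hψ, hψf, hψJ⟩ := hJ
  have hm1 := fun n => TimeStep.aestronglyMeasurable_integ hw hwW hs ht (hφ n)
  have hm2 := fun n => TimeStep.aestronglyMeasurable_integ hw hwW hs ht (hψ n)
  -- I and J are compared through both elementary integrals. The isometry moves the middle distance
  -- to the time axis, where both step functions approach f.
  have hle : ∀ n, eLpNorm (fun ω => I ω - J ω) 2 P ≤
      eLpNorm (fun ω => (φ n).integ W ω - I ω) 2 P +
      (eLpNorm (fun r => (φ n).eval r - f r) 2 (volume.restrict (Ioc s t)) +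
        eLpNorm (fun r => (ψ n).eval r - f r) 2 (volume.restrict (Ioc s t))) +
      eLpNorm (fun ω => (ψ n).integ W ω - J ω) 2 P := fun n => by
    have h1 : eLpNorm (fun r => (φ n).eval r - (ψ n).eval r) 2 (volume.restrict (Ioc s t)) ≤
        eLpNorm (fun r => (φ n).eval r - f r) 2 (volume.restrict (Ioc s t)) +
        eLpNorm (fun r => (ψ n).eval r - f r) 2 (volume.restrict (Ioc s t)) := by
      have := eLpNorm_sub_le ((φ n).measurable_eval.aestronglyMeasurable.sub hf)
        ((ψ n).measurable_eval.aestronglyMeasurable.sub hf) (p := 2) (by norm_num)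
      refine le_trans (le_of_eq ?_) this
      congr 1; ext r; simp
    rw [← TimeStep.eLpNorm_integ_sub hw hwW hs ht (hφ n) (hψ n)] at h1
    have h2 := eLpNorm_sub_le ((hm1 n).sub (hm2 n)) ((hm1 n).sub hIm) (p := 2) (by norm_num)
    have h3 := eLpNorm_add_le (((hm1 n).sub (hm2 n)).sub ((hm1 n).sub hIm))
      ((hm2 n).sub hJm) (p := 2) (by norm_num)
    calc eLpNorm (fun ω => I ω - J ω) 2 P
        = eLpNorm (((φ n).integ W - (ψ n).integ W) - ((φ n).integ W - I) +
            ((ψ n).integ W - J)) 2 P := by congr 1; ext ω; simp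
      _ ≤ _ := h3.trans (add_le_add_left (h2.trans ?_) _)
    rw [add_comm]
    exact add_le_add_right h1 _
  have hlim := ((hφI.add (hφf.add hψf)).add hψJ)
  simp only [add_zero] at hlim
  have h0 := le_antisymm (ge_of_tendsto' hlim hle) zero_le
  rw [eLpNorm_eq_zero_iff (f := fun ω => I ω - J ω) (hIm.sub hJm) (by norm_num)] at h0
  filter_upwards [h0] with ω hω
  exact sub_eq_zero.1 hω

/-- The left end points of a step function on a uniform grid approximate a Lipschitz function. -/
theorem abs_sum_indicator_sub_le {f : ℝ → ℝ} {s t δ C : ℝ} {n : ℕ} (hδ : 0 ≤ δ) (hC : 0 ≤ C)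
    (hn : s + n * δ ≤ t)
    (hf : ∀ x ∈ Icc s t, ∀ y ∈ Icc s t, |f x - f y| ≤ C * |x - y|) {r : ℝ} (hr : s < r) :
    (r ≤ s + n * δ → |(∑ i ∈ Finset.range n, f (s + i * δ) *
      (Ioc (s + i * δ) (s + (i + 1 : ℕ) * δ)).indicator (fun _ => (1 : ℝ)) r) - f r| ≤ C * δ) ∧
    (s + n * δ < r → (∑ i ∈ Finset.range n, f (s + i * δ) *
      (Ioc (s + i * δ) (s + (i + 1 : ℕ) * δ)).indicator (fun _ => (1 : ℝ)) r) = 0) := by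
  -- The second conclusion, that the sum vanishes beyond the grid, is what isolates the new cell in
  -- the induction.
  induction n with
  | zero => exact ⟨fun h => absurd h (by simpa using hr), fun _ => by simp⟩
  | succ n ih =>
    have hnδ : 0 ≤ n * δ := by positivity
    push_cast at hn
    have h1 : s + n * δ ≤ t := by nlinarith
    obtain ⟨ih1, ih2⟩ := ih h1
    rw [Finset.sum_range_succ]
    refine ⟨fun h => ?_, fun h => ?_⟩
    · rcases le_or_gt r (s + n * δ) with h2 | h2
      · rw [indicator_of_notMem (fun hm => absurd hm.1 (not_lt.2 h2)), mul_zero, add_zero]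
        exact ih1 h2
      · rw [ih2 h2, indicator_of_mem (show r ∈ Ioc _ _ from ⟨h2, h⟩), zero_add, mul_one]
        push_cast at h
        refine (hf _ ⟨by linarith, h1⟩ _ ⟨hr.le, by linarith⟩).trans ?_
        refine mul_le_mul_of_nonneg_left ?_ hC
        rw [abs_le]; constructor <;> linarith
    · have h2 : s + n * δ < r := by push_cast at h; linarith
      rw [ih2 h2, indicator_of_notMem (fun hm => absurd hm.2 (not_le.2 h)), mul_zero, add_zero]

theorem integral_eq_sub_of_hasDerivAt_Ioo {f f' : ℝ → ℝ} {s t : ℝ} (hf : ContinuousOn f (Icc s t))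
    (hf' : ContinuousOn f' (Icc s t)) (hd : ∀ x ∈ Ioo s t, HasDerivAt f (f' x) x) {x y : ℝ}
    (hx : s ≤ x) (hxy : x ≤ y) (hy : y ≤ t) : ∫ r in x..y, f' r = f y - f x := by
  have hsub : Icc x y ⊆ Icc s t := Icc_subset_Icc hx hy
  refine intervalIntegral.integral_eq_sub_of_hasDerivAt_of_le hxy (hf.mono hsub)
    (fun r hr => hd r ⟨hx.trans_lt hr.1, hr.2.trans_le hy⟩) ?_
  exact (hf'.mono hsub).intervalIntegrable_of_Icc hxy

theorem abs_sub_le_of_abs_deriv_le {f f' : ℝ → ℝ} {s t B : ℝ} (hf : ContinuousOn f (Icc s t))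
    (hf' : ContinuousOn f' (Icc s t)) (hd : ∀ x ∈ Ioo s t, HasDerivAt f (f' x) x)
    (hB : ∀ x ∈ Icc s t, |f' x| ≤ B) {x y : ℝ} (hx : x ∈ Icc s t) (hy : y ∈ Icc s t) :
    |f x - f y| ≤ B * |x - y| := by
  wlog hxy : x ≤ y generalizing x y
  · rw [abs_sub_comm, abs_sub_comm x]
    exact this hy hx (le_of_not_ge hxy)
  rw [abs_sub_comm, ← integral_eq_sub_of_hasDerivAt_Ioo hf hf' hd hx.1 hxy hy.2, abs_sub_comm x]
  rw [← Real.norm_eq_abs]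
  refine intervalIntegral.norm_integral_le_of_norm_le_const fun r hr => ?_
  rw [uIoc_of_le hxy] at hr
  exact hB r ⟨hx.1.trans hr.1.le, hr.2.trans hy.2⟩

/-- Summation by parts. The elementary integral with left end points differs from the integrated
expression only by integrals of f' against fluctuations of g inside one cell, so the difference is
small when g is a Brownian path. -/
theorem sum_integral_grid {f f' g : ℝ → ℝ} {s t δ : ℝ} (hf : ContinuousOn f (Icc s t))
    (hf' : ContinuousOn f' (Icc s t)) (hd : ∀ x ∈ Ioo s t, HasDerivAt f (f' x) x)
    (hg : Continuous g) (hδ : 0 ≤ δ) {n : ℕ} (hn : s + n * δ ≤ t) :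
    ∑ i ∈ Finset.range n, (∫ r in (s + i * δ)..(s + (i + 1 : ℕ) * δ),
      f' r * (g r - g (s + (i + 1 : ℕ) * δ))) =
    ∑ i ∈ Finset.range n, f (s + i * δ) * (g (s + (i + 1 : ℕ) * δ) - g (s + i * δ)) -
      (f (s + n * δ) * g (s + n * δ) - f s * g s - ∫ r in s..(s + n * δ), f' r * g r) := by
  induction n with
  | zero => simp
  | succ n ih =>
    have hnδ : 0 ≤ n * δ := by positivity
    have hle : s + n * δ ≤ s + (n + 1 : ℕ) * δ := by push_cast; linarith
    have hii : ∀ {x y}, s ≤ x → x ≤ y → y ≤ t → IntervalIntegrable (fun r => f' r * g r) volume x y :=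
      fun h1 h2 h3 => ((hf'.mono (Icc_subset_Icc h1 h3)).mul
        hg.continuousOn).intervalIntegrable_of_Icc h2
    have hif : IntervalIntegrable f' volume (s + n * δ) (s + (n + 1 : ℕ) * δ) :=
      (hf'.mono (Icc_subset_Icc (by linarith) hn)).intervalIntegrable_of_Icc hle
    rw [Finset.sum_range_succ, Finset.sum_range_succ, ih (hle.trans hn),
      ← intervalIntegral.integral_add_adjacent_intervals
        (hii le_rfl (by linarith) (hle.trans hn)) (hii (by linarith) hle hn)]
    have h1 : ∫ r in (s + n * δ)..(s + (n + 1 : ℕ) * δ), f' r * (g r - g (s + (n + 1 : ℕ) * δ)) =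
        (∫ r in (s + n * δ)..(s + (n + 1 : ℕ) * δ), f' r * g r) -
          (f (s + (n + 1 : ℕ) * δ) - f (s + n * δ)) * g (s + (n + 1 : ℕ) * δ) := by
      simp_rw [mul_sub]
      rw [intervalIntegral.integral_sub (hii (by linarith) hle hn) (hif.mul_const _),
        intervalIntegral.integral_mul_const,
        integral_eq_sub_of_hasDerivAt_Ioo hf hf' hd (by linarith) hle hn]
    rw [h1]
    ring

/-- The Itô integral of a continuously differentiable integrand, by integration by parts. -/
theorem isItoIntegral_by_parts [IsProbabilityMeasure P] (hw : IsContBrownian P w t₀ T)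
    (hwW : ∀ᵐ ω ∂P, ∀ t ∈ Icc t₀ T, w t ω = W t.toNNReal ω) {s t : ℝ} (hs : t₀ ≤ s) (h0 : 0 ≤ s)
    (hst : s ≤ t) (ht : t ≤ T) {f f' : ℝ → ℝ} (hf : ContinuousOn f (Icc s t))
    (hf' : ContinuousOn f' (Icc s t)) (hd : ∀ x ∈ Ioo s t, HasDerivAt f (f' x) x) :
    IsItoIntegral P W f s t
      (fun ω => f t * w t ω - f s * w s ω - ∫ r in s..t, f' r * w r ω) := by
  obtain ⟨B, hB⟩ := isCompact_Icc.exists_bound_of_continuousOn hf'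
  simp only [Real.norm_eq_abs] at hB
  have hB0 : 0 ≤ B := (abs_nonneg _).trans (hB s ⟨le_rfl, hst⟩)
  -- The interval is cut into n + 1 cells, so that the mesh is meaningful for n = 0.
  let δ : ℕ → ℝ := fun n => (t - s) / (n + 1 : ℕ)
  have hδ0 : ∀ n, 0 ≤ δ n := fun n => div_nonneg (sub_nonneg.2 hst) (Nat.cast_nonneg _)
  have hδn : ∀ n, s + (n + 1 : ℕ) * δ n = t := fun n => by
    simp only [δ]; field_simp; ring
  have hδlim : Tendsto δ atTop (𝓝 0) := by
    have := (tendsto_const_div_atTop_nhds_zero_nat (t - s)).comp (tendsto_add_atTop_nat 1)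
    exact this
  have hle : ∀ (n i : ℕ), i ≤ n + 1 → s + i * δ n ≤ t := fun n i hi => by
    have := mul_le_mul_of_nonneg_right (Nat.cast_le (α := ℝ).2 hi) (hδ0 n)
    linarith [hδn n]
  have hge : ∀ n (i : ℕ), s ≤ s + i * δ n := fun n i =>
    le_add_of_nonneg_right (mul_nonneg (Nat.cast_nonneg _) (hδ0 n))
  have hstep : ∀ n (i : ℕ), s + i * δ n ≤ s + (i + 1 : ℕ) * δ n := fun n i => by
    push_cast; linarith [hδ0 n]
  have hcoe : ∀ n (i : ℕ), ((s + i * δ n).toNNReal : ℝ) = s + i * δ n := fun n i =>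
    Real.coe_toNNReal _ (h0.trans (hge n i))
  let φ : ℕ → TimeStep := fun n =>
    { n := n + 1
      c := fun i => f (s + (i : ℕ) * δ n)
      u := fun i => (s + (i : ℕ) * δ n).toNNReal
      v := fun i => (s + ((i : ℕ) + 1 : ℕ) * δ n).toNNReal
      le := fun i => Real.toNNReal_le_toNNReal (hstep n i) }
  have hφ : ∀ n i, s ≤ (φ n).u i ∧ ((φ n).v i : ℝ) ≤ t := fun n i => by
    simp only [φ, hcoe]
    exact ⟨hge n i, hle n _ i.2⟩
  refine ⟨φ, hφ, ?_, ?_⟩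
  · have hlim : Tendsto (fun n => (volume.restrict (Ioc s t)) univ ^ (2 : ℝ≥0∞).toReal⁻¹ *
        ENNReal.ofReal (B * δ n)) atTop (𝓝 0) := by
      have h1 : Tendsto (fun n => ENNReal.ofReal (B * δ n)) atTop (𝓝 0) := by
        simpa using ENNReal.tendsto_ofReal (hδlim.const_mul B)
      have h2 := ENNReal.Tendsto.const_mul h1 (a := (volume.restrict (Ioc s t)) univ ^
        (2 : ℝ≥0∞).toReal⁻¹) (Or.inr (by simp))
      simpa only [mul_zero] using h2
    refine tendsto_of_tendsto_of_tendsto_of_le_of_le tendsto_const_nhds hlim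
      (fun _ => zero_le) fun n => eLpNorm_le_of_ae_bound ?_
    refine (ae_restrict_iff' measurableSet_Ioc).2 (ae_of_all _ fun r hr => ?_)
    have h := (abs_sum_indicator_sub_le (n := n + 1) (hδ0 n) hB0 (hδn n).le
      (fun x hx y hy => abs_sub_le_of_abs_deriv_le hf hf' hd hB hx hy) hr.1).1
      (hr.2.trans (hδn n).ge)
    rw [← Fin.sum_univ_eq_sum_range (fun i => f (s + i * δ n) *
      (Ioc (s + i * δ n) (s + (i + 1 : ℕ) * δ n)).indicator (fun _ => (1 : ℝ)) r)] at h
    simp only [TimeStep.eval, φ, hcoe, Real.norm_eq_abs]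
    exact h
  -- Each of the n + 1 cells contributes at most δ · B√δ, and the cells have total length t - s.
  · have hrms : ∀ n, RmsLe P (fun ω => (φ n).integ W ω -
        (f t * w t ω - f s * w s ω - ∫ r in s..t, f' r * w r ω)) ((t - s) * (B * √(δ n))) := by
      intro n
      have h1 := rmsLe_sum (P := P) (n := n + 1) (f := fun i ω =>
        ∫ r in (s + i * δ n)..(s + (i + 1 : ℕ) * δ n),
          f' r * (w r ω - w (s + (i + 1 : ℕ) * δ n) ω)) (c := δ n * (B * √(δ n))) fun i hi => by
        have hsub := Icc_subset_Icc (hge n i) (hle n (i + 1) hi)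
        have h2 := hw.rmsLe_integral_mul_sub (hs.trans (hge n i)) ((hle n (i + 1) hi).trans ht)
          (hf'.mono hsub) ⟨hstep n i, le_rfl⟩ fun r hr => hB r (hsub hr)
        have h3 : s + (i + 1 : ℕ) * δ n - (s + i * δ n) = δ n := by push_cast; ring
        rwa [h3] at h2
      have h4 : ((n + 1 : ℕ) : ℝ) * (δ n * (B * √(δ n))) = (t - s) * (B * √(δ n)) := by
        rw [← mul_assoc]; congr 1; linarith [hδn n]
      rw [h4] at h1
      refine h1.congr ?_
      filter_upwards [(φ n).integ_ae_eq hwW hs ht (hφ n)] with ω hω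
      rw [hω, sum_integral_grid hf hf' hd (hw.continuous ω) (hδ0 n) (hδn n).le, hδn n]
      congr 1
      simp only [φ, hcoe]
      rw [Fin.sum_univ_eq_sum_range (fun i => f (s + i * δ n) *
        (w (s + (i + 1 : ℕ) * δ n) ω - w (s + i * δ n) ω))]
    have hlim : Tendsto (fun n => ENNReal.ofReal ((t - s) * (B * √(δ n)))) atTop (𝓝 0) := by
      have h1 : Tendsto (fun n => √(δ n)) atTop (𝓝 0) := by
        simpa [Function.comp_def] using (Real.continuous_sqrt.tendsto 0).comp hδlim
      simpa using ENNReal.tendsto_ofReal ((h1.const_mul B).const_mul (t - s))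
    exact tendsto_of_tendsto_of_tendsto_of_le_of_le tendsto_const_nhds hlim
      (fun _ => zero_le) fun n => (hrms n).eLpNorm_le

end Ito

/-! ### Variation of constants, along one path and for the SDE -/

/-- `f` is continuous on `[s, t]` and has there the continuous derivative `f'`. -/
structure HasContDerivOn (f f' : ℝ → ℝ) (s t : ℝ) : Prop where
  continuousOn : ContinuousOn f (Icc s t)
  continuousOn_deriv : ContinuousOn f' (Icc s t)
  hasDerivAt : ∀ x ∈ Ioo s t, HasDerivAt f (f' x) x

namespace HasContDerivOn

variable {f f' : ℝ → ℝ} {s t : ℝ}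

theorem mono (h : HasContDerivOn f f' s t) {u v : ℝ} (hu : s ≤ u) (hv : v ≤ t) :
    HasContDerivOn f f' u v where
  continuousOn := h.continuousOn.mono (Icc_subset_Icc hu hv)
  continuousOn_deriv := h.continuousOn_deriv.mono (Icc_subset_Icc hu hv)
  hasDerivAt x hx := h.hasDerivAt x ⟨hu.trans_lt hx.1, hx.2.trans_le hv⟩

theorem integral_eq (h : HasContDerivOn f f' s t) {x y : ℝ} (hx : s ≤ x) (hxy : x ≤ y)
    (hy : y ≤ t) : ∫ r in x..y, f' r = f y - f x :=
  integral_eq_sub_of_hasDerivAt_Ioo h.continuousOn h.continuousOn_deriv h.hasDerivAt hx hxy hy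

theorem abs_sub_le (h : HasContDerivOn f f' s t) {B : ℝ} (hB : ∀ x ∈ Icc s t, |f' x| ≤ B) {x y : ℝ}
    (hx : x ∈ Icc s t) (hy : y ∈ Icc s t) : |f x - f y| ≤ B * |x - y| :=
  abs_sub_le_of_abs_deriv_le h.continuousOn h.continuousOn_deriv h.hasDerivAt hB hx hy

theorem primitive {g : ℝ → ℝ} (hst : s ≤ t) (hg : ContinuousOn g (Icc s t)) :
    HasContDerivOn (fun r => ∫ u in s..r, g u) g s t where
  continuousOn := by
    have := intervalIntegral.continuousOn_primitive_interval'
      (hg.intervalIntegrable_of_Icc (μ := volume) hst) left_mem_uIcc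
    rwa [uIcc_of_le hst] at this
  continuousOn_deriv := hg
  hasDerivAt x hx := by
    refine intervalIntegral.integral_hasDerivAt_right
      ((hg.mono (Icc_subset_Icc_right hx.2.le)).intervalIntegrable_of_Icc hx.1.le) ?_ ?_
    · exact (hg.mono Ioo_subset_Icc_self).stronglyMeasurableAtFilter isOpen_Ioo x hx
    · exact hg.continuousAt (Icc_mem_nhds hx.1 hx.2)

end HasContDerivOn

theorem TwiceDifferentiableOn.hasContDerivOn {f : ℝ → ℝ} {t₀ T : ℝ}
    (h : TwiceDifferentiableOn f t₀ T) :
    HasContDerivOn f (derivWithin f (Icc t₀ T)) t₀ T where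
  continuousOn := h.1.continuousOn
  continuousOn_deriv := h.2.continuousOn
  hasDerivAt x hx := (h.1 x (Ioo_subset_Icc_self hx)).hasDerivWithinAt.hasDerivAt
    (Icc_mem_nhds hx.1 hx.2)

/-- Variation of constants along one path. -/
theorem variation_of_constants {a A b b' x w : ℝ → ℝ} {t₀ T : ℝ} (hA : HasContDerivOn A a t₀ T)
    (hb : HasContDerivOn b b' t₀ T) (hx : ContinuousOn x (Icc t₀ T)) (hw : Continuous w)
    (heq : ∀ t ∈ Icc t₀ T, x t - x t₀ - ∫ r in t₀..t, a r * x r =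
      b t * w t - b t₀ * w t₀ - ∫ r in t₀..t, b' r * w r) {s t : ℝ} (hs : t₀ ≤ s) (hst : s ≤ t)
    (ht : t ≤ T) :
    x t = Real.exp (A t - A s) * x s + b t * (w t - w s) +
      ∫ r in s..t, Real.exp (A t - A r) * (a r * b r - b' r) * (w r - w s) := by
  have ha := hA.continuousOn_deriv
  have hq1 : ContinuousOn (fun r => a r * x r) (Icc t₀ T) := ha.mul hx
  have hq2 : ContinuousOn (fun r => b' r * w r) (Icc t₀ T) :=
    hb.continuousOn_deriv.mul hw.continuousOn
  have hT : t₀ ≤ T := hs.trans (hst.trans ht)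
  have hQ1 := HasContDerivOn.primitive hT hq1
  have hQ2 := HasContDerivOn.primitive hT hq2
  set Q1 : ℝ → ℝ := fun r => ∫ u in t₀..r, a u * x u with hQ1def
  set Q2 : ℝ → ℝ := fun r => ∫ u in t₀..r, b' u * w u with hQ2def
  -- Although x need not be differentiable, x - b w is a difference of primitives and hence C¹.
  have hY : ∀ r ∈ Icc t₀ T, x r - b r * w r = x t₀ - b t₀ * w t₀ + (Q1 r - Q2 r) := fun r hr => by
    have := heq r hr
    simp only [hQ1def, hQ2def]
    linarith
  -- With w frozen at time s in the last term, the bracket equals x - b (w - w s); differentiating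
  -- cancels x and leaves only (ab - b')(w - w s).
  have hD : HasContDerivOn
      (fun r => Real.exp (A t - A r) * (x t₀ - b t₀ * w t₀ + (Q1 r - Q2 r) + b r * w s))
      (fun r => Real.exp (A t - A r) * (a r * b r - b' r) * (w r - w s)) t₀ T := by
    refine ⟨?_, ?_, fun r hr => ?_⟩
    · exact (Real.continuous_exp.comp_continuousOn (continuousOn_const.sub hA.continuousOn)).mul
        ((continuousOn_const.add (hQ1.continuousOn.sub hQ2.continuousOn)).add
          (hb.continuousOn.mul continuousOn_const))
    · exact ((Real.continuous_exp.comp_continuousOn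
        (continuousOn_const.sub hA.continuousOn)).mul
          ((ha.mul hb.continuousOn).sub hb.continuousOn_deriv)).mul
          (hw.continuousOn.sub continuousOn_const)
    · have h1 := ((hA.hasDerivAt r hr).const_sub (A t)).exp
      have h2 := (((hQ1.hasDerivAt r hr).sub (hQ2.hasDerivAt r hr)).const_add
        (x t₀ - b t₀ * w t₀)).add ((hb.hasDerivAt r hr).mul_const (w s))
      have h3 := hY r (Ioo_subset_Icc_self hr)
      refine (h1.mul h2).congr_deriv ?_
      simp only [Pi.sub_apply, Pi.add_apply]
      rw [← h3]
      ring
  have h := hD.integral_eq hs hst ht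
  simp only [← hY t ⟨hs.trans hst, ht⟩, ← hY s ⟨hs, hst.trans ht⟩, sub_self, Real.exp_zero] at h
  rw [h]
  ring

theorem aestronglyMeasurable_integral_mul {Ω : Type*} [MeasurableSpace Ω] {P : Measure Ω}
    [IsProbabilityMeasure P] {g : ℝ → ℝ} {Z : ℝ → Ω → ℝ} {s t : ℝ} (hst : s ≤ t)
    (hg : ContinuousOn g (Icc s t)) (hZ : Measurable (Function.uncurry Z)) :
    AEStronglyMeasurable (fun ω => ∫ r in s..t, g r * Z r ω) P := by
  have h1 : AEStronglyMeasurable g (volume.restrict (Ioc s t)) :=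
    (hg.mono Ioc_subset_Icc_self).aestronglyMeasurable measurableSet_Ioc
  have h2 : AEStronglyMeasurable (fun p : ℝ × Ω => g p.1 * Z p.1 p.2)
      ((volume.restrict (Ioc s t)).prod P) := h1.comp_fst.mul hZ.aestronglyMeasurable
  simp_rw [intervalIntegral.integral_of_le hst]
  exact h2.prod_swap.integral_prod_right'

/-- The exceptional null set may depend on t. Discarding those of a dense sequence of times
suffices, since both sides are continuous. -/
theorem forall_eq_of_ae_eq {Ω : Type*} [MeasurableSpace Ω] {P : Measure Ω} {L R : ℝ → Ω → ℝ}
    {t₀ T : ℝ} (hT : t₀ ≤ T) (hL : ∀ ω, ContinuousOn (fun t => L t ω) (Icc t₀ T))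
    (hR : ∀ ω, ContinuousOn (fun t => R t ω) (Icc t₀ T)) (h : ∀ t ∈ Icc t₀ T, L t =ᵐ[P] R t) :
    ∀ᵐ ω ∂P, ∀ t ∈ Icc t₀ T, L t ω = R t ω := by
  have : Nonempty (Icc t₀ T) := ⟨⟨t₀, le_rfl, hT⟩⟩
  have h1 : ∀ᵐ ω ∂P, ∀ n, L (TopologicalSpace.denseSeq (Icc t₀ T) n) ω =
      R (TopologicalSpace.denseSeq (Icc t₀ T) n) ω :=
    ae_all_iff.2 fun n => h _ (TopologicalSpace.denseSeq (Icc t₀ T) n).2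
  filter_upwards [h1] with ω hω t ht
  have h2 := Continuous.ext_on (TopologicalSpace.denseRange_denseSeq (Icc t₀ T))
    (continuousOn_iff_continuous_domRestrict.1 (hL ω)) (continuousOn_iff_continuous_domRestrict.1 (hR ω))
    (by rintro _ ⟨n, rfl⟩; exact hω n)
  exact congrFun h2 ⟨t, ht⟩

/-- Variation of constants for the linear SDE with additive noise. -/
theorem IsLinearSDESolution.variation_of_constants {Ω : Type*} [mΩ : MeasurableSpace Ω]
    {P : Measure Ω} [IsProbabilityMeasure P] {F : Filtration ℝ≥0 mΩ} {W : ℝ≥0 → Ω → ℝ}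
    {a A b b' : ℝ → ℝ} {t₀ T : ℝ} {X w : ℝ → Ω → ℝ} (hX : IsLinearSDESolution P F W a b t₀ T X)
    (ht₀ : 0 ≤ t₀) (hT : t₀ ≤ T) (hA : HasContDerivOn A a t₀ T) (hb : HasContDerivOn b b' t₀ T)
    (hw : IsContBrownian P w t₀ T) (hwW : ∀ᵐ ω ∂P, ∀ t ∈ Icc t₀ T, w t ω = W t.toNNReal ω) :
    ∀ᵐ ω ∂P, ∀ s t, t₀ ≤ s → s ≤ t → t ≤ T →
      X t ω = Real.exp (A t - A s) * X s ω + b t * (w t ω - w s ω) +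
        ∫ r in s..t, Real.exp (A t - A r) * (a r * b r - b' r) * (w r ω - w s ω) := by
  -- The modification x is jointly measurable, so the time integral of a x is a random variable and
  -- the uniqueness of the Itô integral applies.
  obtain ⟨x, hxm, hxc, hxX⟩ := exists_continuous_modification hT
    (fun t ht => ((hX.adapted t ht).mono (F.le _)).measurable) hX.continuous
  have hx : ∀ t, Measurable (x t) := fun t => hxm.of_uncurry_left
  have hwm : ∀ t, Measurable (w t) := fun t => hw.measurable_uncurry.of_uncurry_left
  have ha := hA.continuousOn_deriv
  have hI : ∀ t ∈ Icc t₀ T, (fun ω => X t ω - X t₀ ω - ∫ r in t₀..t, a r * X r ω) =ᵐ[P]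
      fun ω => x t ω - x t₀ ω - ∫ r in t₀..t, a r * x r ω := fun t ht => by
    filter_upwards [hxX] with ω hω
    rw [hω t ht, hω t₀ ⟨le_rfl, hT⟩]
    congr 1
    refine intervalIntegral.integral_congr fun r hr => ?_
    rw [uIcc_of_le ht.1] at hr
    simp only [hω r ⟨hr.1, hr.2.trans ht.2⟩]
  have hae : ∀ t ∈ Icc t₀ T, (fun ω => x t ω - x t₀ ω - ∫ r in t₀..t, a r * x r ω) =ᵐ[P]
      fun ω => b t * w t ω - b t₀ * w t₀ ω - ∫ r in t₀..t, b' r * w r ω := fun t ht => by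
    have hsub : Icc t₀ t ⊆ Icc t₀ T := Icc_subset_Icc_right ht.2
    have hbt := hb.mono le_rfl ht.2
    have hxI : AEStronglyMeasurable (fun ω => x t ω - x t₀ ω - ∫ r in t₀..t, a r * x r ω) P :=
      ((hx t).sub (hx t₀)).aestronglyMeasurable.sub
        (aestronglyMeasurable_integral_mul ht.1 (ha.mono hsub) hxm)
    have hwI : AEStronglyMeasurable
        (fun ω => b t * w t ω - b t₀ * w t₀ ω - ∫ r in t₀..t, b' r * w r ω) P :=
      (((hwm t).const_mul _).sub ((hwm t₀).const_mul _)).aestronglyMeasurable.sub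
        (aestronglyMeasurable_integral_mul ht.1 (hb.continuousOn_deriv.mono hsub)
          hw.measurable_uncurry)
    exact (hI t ht).symm.trans (IsItoIntegral.ae_eq hw hwW le_rfl ht.2
      ((hbt.continuousOn.mono Ioc_subset_Icc_self).aestronglyMeasurable measurableSet_Ioc)
      (hxI.congr (hI t ht).symm) hwI (hX.integral_eq t ht)
      (isItoIntegral_by_parts hw hwW le_rfl ht₀ ht.1 ht.2 hbt.continuousOn
        hbt.continuousOn_deriv hbt.hasDerivAt))
  have hall := forall_eq_of_ae_eq
    (L := fun t ω => x t ω - x t₀ ω - ∫ r in t₀..t, a r * x r ω)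
    (R := fun t ω => b t * w t ω - b t₀ * w t₀ ω - ∫ r in t₀..t, b' r * w r ω) hT (fun ω => ((hxc ω).continuousOn.sub continuousOn_const).sub
      (HasContDerivOn.primitive hT (ha.mul (hxc ω).continuousOn)).continuousOn)
    (fun ω => ((hb.continuousOn.mul (hw.continuous ω).continuousOn).sub continuousOn_const).sub
      (HasContDerivOn.primitive hT
        (hb.continuousOn_deriv.mul (hw.continuous ω).continuousOn)).continuousOn) hae
  filter_upwards [hall, hxX] with ω hω hxω s t hs hst ht
  rw [← hxω t ⟨hs.trans hst, ht⟩, ← hxω s ⟨hs, hst.trans ht⟩]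
  exact _root_.variation_of_constants hA hb (hxc ω).continuousOn (hw.continuous ω) hω hs hst ht

/-- In the exact differential case `b W` solves the equation. -/
theorem isLinearSDESolution_mul_brownian {Ω : Type*} [mΩ : MeasurableSpace Ω]
    {P : Measure Ω} [IsProbabilityMeasure P] {F : Filtration ℝ≥0 mΩ} {W : ℝ≥0 → Ω → ℝ}
    (hW : IsFilteredBrownian P F W) {a b b' : ℝ → ℝ} {t₀ T : ℝ} (ht₀ : 0 ≤ t₀) (hT : t₀ ≤ T)
    (hb : HasContDerivOn b b' t₀ T) (hab : ∀ t ∈ Icc t₀ T, a t * b t = b' t) :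
    IsLinearSDESolution P F W a b t₀ T fun t ω => b t * W t.toNNReal ω where
  adapted t _ := (hW.adapted _).const_mul _
  continuous := hW.brownian.cont.mono fun ω hω =>
    hb.continuousOn.mul (hω.comp continuous_real_toNNReal).continuousOn
  integral_eq t ht := by
    obtain ⟨w, hw, hwW⟩ := hW.exists_isContBrownian ht₀ hT
    have hbt := hb.mono le_rfl ht.2
    obtain ⟨φ, hφ, hφf, hφI⟩ := isItoIntegral_by_parts hw hwW le_rfl ht₀ ht.1 ht.2
      hbt.continuousOn hbt.continuousOn_deriv hbt.hasDerivAt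
    refine ⟨φ, hφ, hφf, hφI.congr fun n => eLpNorm_congr_ae ?_⟩
    filter_upwards [hwW] with ω hω
    simp only [hω t ht, hω t₀ ⟨le_rfl, hT⟩]
    congr 2
    -- Since ab = b', the drift integral of b W is exactly the correction term of integration by
    -- parts.
    refine intervalIntegral.integral_congr fun r hr => ?_
    rw [uIcc_of_le ht.1] at hr
    have hr' : r ∈ Icc t₀ T := ⟨hr.1, hr.2.trans ht.2⟩
    simp only [hω r hr', ← hab r hr', mul_assoc]

/-! ### One step of the scheme as an affine map -/

/-- The factor by which one step of the scheme for `dX = a(t) X dt + b(t) dW` multiplies its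
initial value. -/
noncomputable def stepFactor (a : ℝ → ℝ) (t h : ℝ) : ℝ :=
  1 + h * ((a t + a (t + h)) / 2) + h ^ 2 * (a t * a (t + h)) / 2

/-- The difference between the exact propagator, in terms of a primitive `A` of `a`, and the factor
of the scheme. -/
noncomputable def driftDefect (A a : ℝ → ℝ) (t h : ℝ) : ℝ :=
  Real.exp (A (t + h) - A t) - stepFactor a t h

/-- The difference between `b (t + h)` and the coefficient of the noise increment in one step of
the scheme. -/
noncomputable def noiseDefect (a b : ℝ → ℝ) (t h : ℝ) : ℝ :=
  (b (t + h) - b t - h * (a (t + h) * b t)) / 2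

/-- The coefficient of ΔW misses b(t + h) by the same defect that multiplies √h S, so one estimate
controls both. -/
theorem rkStep_linear (a b : ℝ → ℝ) (t h x dW σ : ℝ) :
    rkStep (fun t x => a t * x) (fun t _ => b t) t h x dW σ =
      stepFactor a t h * x + (b (t + h) - noiseDefect a b t h) * dW +
        noiseDefect a b t h * √h * σ := by
  simp only [rkStep, stepFactor, noiseDefect]
  ring

/-- The mean value bound for f minus the linear function of slope c. -/
theorem HasContDerivOn.abs_sub_sub_mul_le {f f' : ℝ → ℝ} {s t c B : ℝ}
    (hf : HasContDerivOn f f' s t) (hst : s ≤ t) (hB : ∀ r ∈ Icc s t, |f' r - c| ≤ B) :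
    |f t - f s - (t - s) * c| ≤ B * (t - s) := by
  have h : HasContDerivOn (fun r => f r - r * c) (fun r => f' r - c) s t :=
    ⟨hf.continuousOn.sub (continuousOn_id.mul continuousOn_const),
      hf.continuousOn_deriv.sub continuousOn_const, fun x hx =>
        ((hf.hasDerivAt x hx).sub ((hasDerivAt_id x).mul_const c)).congr_deriv (by simp)⟩
  have h1 := h.abs_sub_le hB (x := t) (y := s) ⟨hst, le_rfl⟩ ⟨le_rfl, hst⟩
  rw [abs_of_nonneg (sub_nonneg.2 hst)] at h1
  convert h1 using 2
  ring

/-! ### Deterministic bounds for the defects -/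

section Estimates

variable {a a' A b b' : ℝ → ℝ} {t₀ T K : ℝ}

/-- The factor is at most 1 + Kh + (Kh)²/2. A bound by exp(Kh) without a constant in front is
needed, because it is raised to the power m. -/
theorem abs_stepFactor_le (hK : ∀ t ∈ Icc t₀ T, |a t| ≤ K) {t h : ℝ} (ht : t₀ ≤ t) (hh : 0 ≤ h)
    (hth : t + h ≤ T) : |stepFactor a t h| ≤ Real.exp (K * h) := by
  have h1 := hK t ⟨ht, by linarith⟩
  have h2 := hK (t + h) ⟨by linarith, hth⟩
  have hK0 : 0 ≤ K := (abs_nonneg _).trans h1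
  refine le_trans ?_ (Real.quadratic_le_exp_of_nonneg (mul_nonneg hK0 hh))
  have h3 : |h * ((a t + a (t + h)) / 2)| ≤ K * h := by
    rw [abs_mul, abs_of_nonneg hh, mul_comm]
    refine mul_le_mul_of_nonneg_right ?_ hh
    rw [abs_le] at *
    constructor <;> linarith
  have h4 : |h ^ 2 * (a t * a (t + h)) / 2| ≤ (K * h) ^ 2 / 2 := by
    rw [abs_div, abs_mul, abs_mul, abs_of_nonneg (sq_nonneg h), abs_two]
    have := mul_le_mul h1 h2 (abs_nonneg _) hK0
    have := mul_le_mul_of_nonneg_left this (sq_nonneg h)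
    linarith
  calc |stepFactor a t h| ≤ |1 + h * ((a t + a (t + h)) / 2)| + |h ^ 2 * (a t * a (t + h)) / 2| :=
        abs_add_le _ _
    _ ≤ |1| + |h * ((a t + a (t + h)) / 2)| + |h ^ 2 * (a t * a (t + h)) / 2| := by
        gcongr; exact abs_add_le _ _
    _ ≤ _ := by rw [abs_one]; linarith

theorem abs_primitive_sub_le (hA : HasContDerivOn A a t₀ T) (hK : ∀ t ∈ Icc t₀ T, |a t| ≤ K)
    {s t : ℝ} (hs : s ∈ Icc t₀ T) (ht : t ∈ Icc t₀ T) : |A t - A s| ≤ K * (T - t₀) := by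
  refine (hA.abs_sub_le hK ht hs).trans (mul_le_mul_of_nonneg_left ?_
    ((abs_nonneg _).trans (hK s hs)))
  rw [abs_le]
  constructor <;> linarith [hs.1, hs.2, ht.1, ht.2]

theorem exp_primitive_sub_le (hA : HasContDerivOn A a t₀ T) (hK : ∀ t ∈ Icc t₀ T, |a t| ≤ K)
    {s t : ℝ} (hs : s ∈ Icc t₀ T) (ht : t ∈ Icc t₀ T) :
    Real.exp (A t - A s) ≤ Real.exp (K * (T - t₀)) :=
  Real.exp_le_exp.2 ((le_abs_self _).trans (abs_primitive_sub_le hA hK hs ht))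

theorem abs_sub_endpoint_le (ha : HasContDerivOn a a' t₀ T) (hK' : ∀ t ∈ Icc t₀ T, |a' t| ≤ K)
    {t h : ℝ} (ht : t₀ ≤ t) (hth : t + h ≤ T) {r s : ℝ} (hr : r ∈ Icc t (t + h))
    (hs : s ∈ Icc t (t + h)) : |a r - a s| ≤ K * h := by
  have hr' : r ∈ Icc t₀ T := ⟨ht.trans hr.1, hr.2.trans hth⟩
  refine (ha.abs_sub_le hK' hr' ⟨ht.trans hs.1, hs.2.trans hth⟩).trans
    (mul_le_mul_of_nonneg_left ?_ ((abs_nonneg _).trans (hK' r hr')))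
  rw [abs_le]
  constructor <;> linarith [hs.1, hs.2, hr.1, hr.2]

theorem abs_sub_trapezoid_le (hA : HasContDerivOn A a t₀ T) (ha : HasContDerivOn a a' t₀ T)
    (hK' : ∀ t ∈ Icc t₀ T, |a' t| ≤ K) {t h : ℝ} (ht : t₀ ≤ t) (hh : 0 ≤ h) (hth : t + h ≤ T) :
    |A (t + h) - A t - h * ((a t + a (t + h)) / 2)| ≤ K * h ^ 2 := by
  have h1 := (hA.mono ht hth).abs_sub_sub_mul_le (c := (a t + a (t + h)) / 2) (B := K * h)
    (by linarith) fun r hr => by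
      have h2 := abs_sub_endpoint_le ha hK' ht hth hr ⟨le_rfl, by linarith⟩
      have h3 := abs_sub_endpoint_le ha hK' ht hth hr ⟨by linarith, le_rfl⟩
      rw [abs_le] at *
      constructor <;> linarith [h2.1, h2.2, h3.1, h3.2]
  rw [add_sub_cancel_left] at h1
  exact h1.trans (le_of_eq (by ring))

/-- The trapezoidal error as a function of its right end point r has derivative (a(r) - a(t) - (r -
t) a'(r))/2, which is O(h²) when a' is Lipschitz; integrating gains the third power. -/
theorem abs_sub_trapezoid_le_of_lipschitz {B : ℝ} (hA : HasContDerivOn A a t₀ T)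
    (ha : HasContDerivOn a a' t₀ T) (hB0 : 0 ≤ B)
    (hB : ∀ x ∈ Icc t₀ T, ∀ y ∈ Icc t₀ T, |a' x - a' y| ≤ B * |x - y|) {t h : ℝ} (ht : t₀ ≤ t)
    (hh : 0 ≤ h) (hth : t + h ≤ T) :
    |A (t + h) - A t - h * ((a t + a (t + h)) / 2)| ≤ B * h ^ 3 := by
  have hψ : HasContDerivOn (fun r => A r - (r - t) * ((a t + a r) / 2))
      (fun r => (a r - a t - (r - t) * a' r) / 2) t (t + h) := by
    have hA := hA.mono ht hth
    have ha := ha.mono ht hth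
    refine ⟨?_, ?_, fun r hr => ?_⟩
    · exact hA.continuousOn.sub ((continuousOn_id.sub continuousOn_const).mul
        ((continuousOn_const.add ha.continuousOn).div_const 2))
    · exact ((ha.continuousOn.sub continuousOn_const).sub
        ((continuousOn_id.sub continuousOn_const).mul ha.continuousOn_deriv)).div_const 2
    · refine ((hA.hasDerivAt r hr).sub (((hasDerivAt_id r).sub_const t).mul
        (((ha.hasDerivAt r hr).const_add (a t)).div_const 2))).congr_deriv ?_
      simp only [id_eq]
      ring
  have h1 := hψ.abs_sub_le (B := B * h * h / 2) (fun r hr => by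
    have h2 := ((ha.mono ht hth).mono le_rfl hr.2).abs_sub_sub_mul_le (c := a' r) (B := B * h)
      hr.1 fun u hu => by
        refine (hB u ⟨ht.trans hu.1, hu.2.trans (hr.2.trans hth)⟩ r
          ⟨ht.trans hr.1, hr.2.trans hth⟩).trans (mul_le_mul_of_nonneg_left ?_ hB0)
        rw [abs_le]
        constructor <;> linarith [hu.1, hu.2, hr.1, hr.2]
    rw [abs_div, abs_two]
    have h3 : B * h * (r - t) ≤ B * h * h :=
      mul_le_mul_of_nonneg_left (by linarith [hr.2]) (mul_nonneg hB0 hh)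
    linarith) (x := t + h) (y := t) ⟨by linarith, le_rfl⟩ ⟨le_rfl, by linarith⟩
  simp only [add_sub_cancel_left, abs_of_nonneg hh, sub_self, zero_mul, sub_zero] at h1
  have h4 : A (t + h) - A t - h * ((a t + a (t + h)) / 2) =
      A (t + h) - h * ((a t + a (t + h)) / 2) - A t := by ring
  rw [h4]
  refine h1.trans ?_
  have : 0 ≤ B * h ^ 3 := by positivity
  nlinarith

theorem abs_exp_sub_sum_le (x : ℝ) (n : ℕ) :
    |Real.exp x - ∑ m ∈ Finset.range n, x ^ m / m.factorial| ≤ |x| ^ n * Real.exp |x| := by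
  have h := Complex.norm_exp_sub_sum_le_norm_mul_exp x n
  rw [Complex.norm_real, Real.norm_eq_abs] at h
  rw [← Real.norm_eq_abs, ← Complex.norm_real]
  push_cast
  exact h

theorem abs_primitive_step_le (hA : HasContDerivOn A a t₀ T) (hK : ∀ t ∈ Icc t₀ T, |a t| ≤ K)
    {t h : ℝ} (ht : t₀ ≤ t) (hh : 0 ≤ h) (hth : t + h ≤ T) : |A (t + h) - A t| ≤ K * h := by
  have := hA.abs_sub_le hK (x := t + h) (y := t) ⟨by linarith, hth⟩ ⟨ht, by linarith⟩
  rwa [add_sub_cancel_left, abs_of_nonneg hh] at this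

theorem abs_driftDefect_le (hA : HasContDerivOn A a t₀ T) (ha : HasContDerivOn a a' t₀ T)
    (hK : ∀ t ∈ Icc t₀ T, |a t| ≤ K) (hK' : ∀ t ∈ Icc t₀ T, |a' t| ≤ K) {t h : ℝ} (ht : t₀ ≤ t)
    (hh : 0 ≤ h) (hth : t + h ≤ T) :
    |driftDefect A a t h| ≤ (K ^ 2 * Real.exp (K * (T - t₀)) + K + K ^ 2) * h ^ 2 := by
  have hm1 : t ∈ Icc t₀ T := ⟨ht, by linarith⟩
  have hm2 : t + h ∈ Icc t₀ T := ⟨by linarith, hth⟩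
  have hK0 : 0 ≤ K := (abs_nonneg _).trans (hK t hm1)
  have hy := abs_primitive_step_le hA hK ht hh hth
  have hyE := Real.exp_le_exp.2 (abs_primitive_sub_le hA hK hm1 hm2)
  have htr := abs_sub_trapezoid_le hA ha hK' ht hh hth
  set y := A (t + h) - A t with hydef
  have h1 := abs_exp_sub_sum_le y 2
  -- At order h² the exponential is needed only up to its linear term; the quadratic term of the
  -- step factor is bounded by itself.
  simp only [Finset.sum_range_succ, Finset.range_zero, Finset.sum_empty, Nat.factorial, pow_zero,
    pow_one, Nat.cast_one, div_one, zero_add, mul_one] at h1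
  have h2 : |y| ^ 2 * Real.exp |y| ≤ (K * h) ^ 2 * Real.exp (K * (T - t₀)) := by gcongr
  have h3 : |h ^ 2 * (a t * a (t + h)) / 2| ≤ K ^ 2 * h ^ 2 := by
    rw [abs_div, abs_mul, abs_mul, abs_of_nonneg (sq_nonneg h), abs_two]
    have := mul_le_mul (hK t hm1) (hK _ hm2) (abs_nonneg _) hK0
    have := mul_le_mul_of_nonneg_left this (sq_nonneg h)
    have : 0 ≤ K ^ 2 * h ^ 2 := by positivity
    linarith
  have h4 : driftDefect A a t h = (Real.exp y - (1 + y)) + (y - h * ((a t + a (t + h)) / 2)) -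
      h ^ 2 * (a t * a (t + h)) / 2 := by
    simp only [driftDefect, stepFactor, hydef]; ring
  rw [h4]
  refine (abs_sub _ _).trans ((add_le_add_left (abs_add_le _ _) _).trans ?_)
  linarith

theorem abs_driftDefect_le_of_lipschitz {B : ℝ} (hA : HasContDerivOn A a t₀ T)
    (ha : HasContDerivOn a a' t₀ T) (hK : ∀ t ∈ Icc t₀ T, |a t| ≤ K)
    (hK' : ∀ t ∈ Icc t₀ T, |a' t| ≤ K) (hB0 : 0 ≤ B)
    (hB : ∀ x ∈ Icc t₀ T, ∀ y ∈ Icc t₀ T, |a' x - a' y| ≤ B * |x - y|) {t h : ℝ} (ht : t₀ ≤ t)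
    (hh : 0 ≤ h) (hth : t + h ≤ T) :
    |driftDefect A a t h| ≤ (K ^ 3 * Real.exp (K * (T - t₀)) + B + B * K * (T - t₀) +
      K ^ 2 * (T - t₀)) * h ^ 3 := by
  have hm1 : t ∈ Icc t₀ T := ⟨ht, by linarith⟩
  have hm2 : t + h ∈ Icc t₀ T := ⟨by linarith, hth⟩
  have hK0 : 0 ≤ K := (abs_nonneg _).trans (hK t hm1)
  have hhL : h ≤ T - t₀ := by linarith
  have hy := abs_primitive_step_le hA hK ht hh hth
  have hyE := Real.exp_le_exp.2 (abs_primitive_sub_le hA hK hm1 hm2)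
  have htr := abs_sub_trapezoid_le_of_lipschitz hA ha hB0 hB ht hh hth
  have haa := abs_sub_endpoint_le ha hK' ht hth (r := t + h) (s := t) ⟨by linarith, le_rfl⟩
    ⟨le_rfl, by linarith⟩
  have hq : |h * ((a t + a (t + h)) / 2)| ≤ K * h := by
    rw [abs_mul, abs_of_nonneg hh, mul_comm]
    refine mul_le_mul_of_nonneg_right ?_ hh
    have h1 := abs_le.1 (hK t hm1)
    have h2 := abs_le.1 (hK _ hm2)
    rw [abs_le]
    constructor <;> linarith
  set y := A (t + h) - A t with hydef
  set z := h * ((a t + a (t + h)) / 2) with hzdef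
  have h1 := abs_exp_sub_sum_le y 3
  simp only [Finset.sum_range_succ, Finset.range_zero, Finset.sum_empty, Nat.factorial, pow_zero,
    pow_one, Nat.cast_one, div_one, zero_add, mul_one] at h1
  have h2 : |y| ^ 3 * Real.exp |y| ≤ (K * h) ^ 3 * Real.exp (K * (T - t₀)) := by gcongr
  have h3 : |(y - z) * ((y + z) / 2)| ≤ B * K * (T - t₀) * h ^ 3 := by
    have h5 : |(y + z) / 2| ≤ K * h := by
      have := abs_le.1 hy
      have := abs_le.1 hq
      rw [abs_le]
      constructor <;> linarith
    rw [abs_mul]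
    calc |y - z| * |(y + z) / 2| ≤ (B * h ^ 3) * (K * h) := by gcongr
      _ ≤ (B * h ^ 3) * (K * (T - t₀)) := by gcongr
      _ = _ := by ring
  have h4 : |h ^ 2 * (a (t + h) - a t) ^ 2 / 8| ≤ K ^ 2 * (T - t₀) * h ^ 3 := by
    rw [abs_of_nonneg (by positivity), ← sq_abs (a (t + h) - a t)]
    calc h ^ 2 * |a (t + h) - a t| ^ 2 / 8 ≤ h ^ 2 * |a (t + h) - a t| ^ 2 := by
          have : 0 ≤ h ^ 2 * |a (t + h) - a t| ^ 2 := by positivity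
          linarith
      _ ≤ h ^ 2 * (K * h) ^ 2 := by gcongr
      _ = K ^ 2 * h * h ^ 3 := by ring
      _ ≤ K ^ 2 * (T - t₀) * h ^ 3 := by gcongr
  -- With z the trapezoidal value of y, the step factor is 1 + z + z²/2 - h²(a(t+h) - a(t))²/8,
  -- because a product is the square of the mean minus the square of half the difference. The last
  -- term is O(h⁴).
  have h6 : driftDefect A a t h = (Real.exp y - (1 + y + y ^ 2 / 2)) + (y - z) +
      (y - z) * ((y + z) / 2) + h ^ 2 * (a (t + h) - a t) ^ 2 / 8 := by
    simp only [driftDefect, stepFactor, hydef, hzdef]; ring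
  rw [h6]
  refine (abs_add_le _ _).trans ((add_le_add_left ((abs_add_le _ _).trans
    (add_le_add_left (abs_add_le _ _) _)) _).trans ?_)
  linarith

theorem abs_noiseDefect_le (hb : HasContDerivOn b b' t₀ T) (hKa : ∀ t ∈ Icc t₀ T, |a t| ≤ K)
    (hKb : ∀ t ∈ Icc t₀ T, |b t| ≤ K) (hKb' : ∀ t ∈ Icc t₀ T, |b' t| ≤ K) {t h : ℝ} (ht : t₀ ≤ t)
    (hh : 0 ≤ h) (hth : t + h ≤ T) : |noiseDefect a b t h| ≤ (K + K ^ 2) * h := by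
  have hm1 : t ∈ Icc t₀ T := ⟨ht, by linarith⟩
  have hm2 : t + h ∈ Icc t₀ T := ⟨by linarith, hth⟩
  have hK0 : 0 ≤ K := (abs_nonneg _).trans (hKa t hm1)
  have h1 := abs_sub_endpoint_le hb hKb' ht hth (r := t + h) (s := t) ⟨by linarith, le_rfl⟩
    ⟨le_rfl, by linarith⟩
  have h2 : |h * (a (t + h) * b t)| ≤ h * (K * K) := by
    rw [abs_mul, abs_of_nonneg hh, abs_mul]
    gcongr
    exacts [hKa _ hm2, hKb _ hm1]
  rw [noiseDefect, abs_div, abs_two]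
  have h3 := abs_sub (b (t + h) - b t) (h * (a (t + h) * b t))
  have : 0 ≤ (K + K ^ 2) * h := by positivity
  linarith

theorem abs_noiseDefect_le_of_exact (ha : HasContDerivOn a a' t₀ T) (hb : HasContDerivOn b b' t₀ T)
    (hab : ∀ t ∈ Icc t₀ T, a t * b t = b' t) (hKa : ∀ t ∈ Icc t₀ T, |a t| ≤ K)
    (hKa' : ∀ t ∈ Icc t₀ T, |a' t| ≤ K) (hKb : ∀ t ∈ Icc t₀ T, |b t| ≤ K)
    (hKb' : ∀ t ∈ Icc t₀ T, |b' t| ≤ K) {t h : ℝ} (ht : t₀ ≤ t) (hh : 0 ≤ h) (hth : t + h ≤ T) :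
    |noiseDefect a b t h| ≤ K ^ 2 * h ^ 2 := by
  have hm1 : t ∈ Icc t₀ T := ⟨ht, by linarith⟩
  have hm2 : t + h ∈ Icc t₀ T := ⟨by linarith, hth⟩
  have hK0 : 0 ≤ K := (abs_nonneg _).trans (hKa t hm1)
  -- Since b' = ab, the derivative of b stays within O(h) of a(t + h) b(t); both factors are
  -- Lipschitz, which accounts for 2K²h.
  have h1 := (hb.mono ht hth).abs_sub_sub_mul_le (c := a (t + h) * b t) (B := 2 * K ^ 2 * h)
    (by linarith) fun r hr => by
      have hr' : r ∈ Icc t₀ T := ⟨ht.trans hr.1, hr.2.trans hth⟩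
      have h2 := abs_sub_endpoint_le ha hKa' ht hth hr (s := t + h) ⟨by linarith, le_rfl⟩
      have h3 := abs_sub_endpoint_le hb hKb' ht hth hr (s := t) ⟨le_rfl, by linarith⟩
      have h4 : b' r - a (t + h) * b t = (a r - a (t + h)) * b r + a (t + h) * (b r - b t) := by
        rw [← hab r hr']; ring
      rw [h4]
      refine (abs_add_le _ _).trans ?_
      rw [abs_mul, abs_mul]
      have h5 := mul_le_mul h2 (hKb r hr') (abs_nonneg _) (mul_nonneg hK0 hh)
      have h6 := mul_le_mul (hKa _ hm2) h3 (abs_nonneg _) hK0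
      linarith
  rw [add_sub_cancel_left] at h1
  rw [noiseDefect, abs_div, abs_two]
  linarith

theorem abs_exp_mul_sub_le (hA : HasContDerivOn A a t₀ T) (hKa : ∀ t ∈ Icc t₀ T, |a t| ≤ K)
    (hKb : ∀ t ∈ Icc t₀ T, |b t| ≤ K) (hKb' : ∀ t ∈ Icc t₀ T, |b' t| ≤ K) {r t : ℝ}
    (hr : r ∈ Icc t₀ T) (ht : t ∈ Icc t₀ T) :
    |Real.exp (A t - A r) * (a r * b r - b' r)| ≤ Real.exp (K * (T - t₀)) * (K ^ 2 + K) := by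
  have hK0 : 0 ≤ K := (abs_nonneg _).trans (hKa t ht)
  rw [abs_mul, Real.abs_exp]
  refine mul_le_mul (exp_primitive_sub_le hA hKa hr ht) ?_ (abs_nonneg _) (Real.exp_pos _).le
  refine (abs_sub _ _).trans (add_le_add ?_ (hKb' r hr))
  rw [abs_mul, pow_two]
  exact mul_le_mul (hKa r hr) (hKb r hr) (abs_nonneg _) hK0

theorem abs_derivWithin_sub_le {f : ℝ → ℝ} {B : ℝ} (hf : DifferentiableOn ℝ f (Icc t₀ T))
    (hB : ∀ t ∈ Icc t₀ T, |derivWithin f (Icc t₀ T) t| ≤ B) {x y : ℝ} (hx : x ∈ Icc t₀ T)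
    (hy : y ∈ Icc t₀ T) : |f x - f y| ≤ B * |x - y| :=
  (convex_Icc t₀ T).norm_image_sub_le_of_norm_derivWithin_le hf hB hy hx

end Estimates

/-! ### Growth of affine recursions in L² -/

theorem integrable_mul_of_memLp_two {Ω : Type*} [MeasurableSpace Ω] {P : Measure Ω} {f g : Ω → ℝ}
    (hf : MemLp f 2 P) (hg : MemLp g 2 P) : Integrable (fun ω => f ω * g ω) P :=
  hf.integrable_mul hg

theorem integral_add_sq {Ω : Type*} [MeasurableSpace Ω] {P : Measure Ω} {f g : Ω → ℝ} (x : ℝ)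
    (hf : MemLp f 2 P) (hg : MemLp g 2 P) (h : ∫ ω, g ω * f ω ∂P = 0) :
    ∫ ω, (x * f ω + g ω) ^ 2 ∂P = x ^ 2 * ∫ ω, f ω ^ 2 ∂P + ∫ ω, g ω ^ 2 ∂P := by
  have h1 : ∀ ω, (x * f ω + g ω) ^ 2 = x ^ 2 * f ω ^ 2 + (2 * x) * (g ω * f ω) + g ω ^ 2 :=
    fun ω => by ring
  have hgf := integrable_mul_of_memLp_two hg hf
  simp_rw [h1]
  rw [integral_add (f := fun ω => x ^ 2 * f ω ^ 2 + (2 * x) * (g ω * f ω))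
      ((hf.integrable_sq.const_mul _).add (hgf.const_mul _)) hg.integrable_sq,
    integral_add (hf.integrable_sq.const_mul _) (hgf.const_mul _), integral_const_mul,
    integral_const_mul, h]
  ring

/-- The solution of the recursion `y (k + 1) = G k * y k + N k` with `y 0 = 0`. -/
def affineRec {Ω : Type*} (G : ℕ → ℝ) (N : ℕ → Ω → ℝ) : ℕ → Ω → ℝ
  | 0, _ => 0
  | k + 1, ω => G k * affineRec G N k ω + N k ω

section AffineRec

variable {Ω : Type*} [MeasurableSpace Ω] {P : Measure Ω} {G : ℕ → ℝ} {N : ℕ → Ω → ℝ} {g c : ℝ}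
  {m : ℕ}

theorem rmsLe_affineRec (hg : 1 ≤ g) (hc : 0 ≤ c) (hG : ∀ k < m, |G k| ≤ g)
    (hN : ∀ k < m, RmsLe P (N k) c) : RmsLe P (affineRec G N m) (g ^ m * (m * c)) := by
  induction m with
  | zero => exact rmsLe_zero (by simp)
  | succ m ih =>
    have h1 := ih (fun k hk => hG k (hk.trans m.lt_succ_self))
      fun k hk => hN k (hk.trans m.lt_succ_self)
    refine ((h1.const_mul (G m)).add (hN m m.lt_succ_self)).mono ?_
    have h2 : |G m| * (g ^ m * (m * c)) ≤ g * (g ^ m * (m * c)) :=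
      mul_le_mul_of_nonneg_right (hG m m.lt_succ_self) h1.2.1
    have h3 : c ≤ g ^ (m + 1) * c := le_mul_of_one_le_left hc (one_le_pow₀ hg)
    calc _ ≤ g * (g ^ m * (m * c)) + g ^ (m + 1) * c := add_le_add h2 h3
      _ = _ := by push_cast; ring

theorem rmsLe_affineRec_of_orthogonal (hg : 1 ≤ g) (hc : 0 ≤ c) (hG : ∀ k < m, |G k| ≤ g)
    (hN : ∀ k < m, RmsLe P (N k) c)
    (horth : ∀ k < m, ∀ j < k, ∫ ω, N k ω * N j ω ∂P = 0) :
    RmsLe P (affineRec G N m) (g ^ m * (√m * c)) := by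
  have hg0 : 0 ≤ g := zero_le_one.trans hg
  -- The induction also carries the orthogonality of all later N k to the current value, so squares
  -- add (Pythagoras) and the bound grows like √m instead of m.
  suffices h : ∀ i ≤ m, RmsLe P (affineRec G N i) (g ^ i * (√i * c)) ∧
      ∀ k < m, i ≤ k → ∫ ω, N k ω * affineRec G N i ω ∂P = 0 from (h m le_rfl).1
  intro i
  induction i with
  | zero =>
    intro _
    exact ⟨rmsLe_zero (by simp), fun k _ _ => by simp [affineRec]⟩
  | succ i ih =>
    intro hi
    obtain ⟨ih1, ih2⟩ := ih (Nat.le_of_succ_le hi)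
    have hNi := hN i hi
    refine ⟨⟨((ih1.const_mul (G i)).add hNi).1, by positivity, ?_⟩, fun k hk hik => ?_⟩
    · simp only [affineRec]
      rw [integral_add_sq (G i) ih1.1 hNi.1 (ih2 i hi le_rfl)]
      have h1 : G i ^ 2 * ∫ ω, affineRec G N i ω ^ 2 ∂P ≤ g ^ 2 * (g ^ i * (√i * c)) ^ 2 :=
        mul_le_mul (sq_le_sq' (by linarith [(abs_le.1 (hG i hi)).1]) (abs_le.1 (hG i hi)).2) ih1.2.2
          (integral_nonneg fun _ => sq_nonneg _) (sq_nonneg g)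
      have h2 : c ^ 2 ≤ (g ^ (i + 1)) ^ 2 * c ^ 2 :=
        le_mul_of_one_le_left (sq_nonneg c) (one_le_pow₀ (one_le_pow₀ hg))
      calc _ ≤ g ^ 2 * (g ^ i * (√i * c)) ^ 2 + (g ^ (i + 1)) ^ 2 * c ^ 2 :=
            add_le_add h1 (hNi.2.2.trans h2)
        _ = _ := by
            simp only [mul_pow, Real.sq_sqrt (Nat.cast_nonneg _)]
            push_cast
            ring
    · simp only [affineRec, mul_add, mul_left_comm _ (G i)]
      rw [integral_add ((integrable_mul_of_memLp_two (hN k hk).1 ih1.1).const_mul _)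
        (integrable_mul_of_memLp_two (hN k hk).1 hNi.1), integral_const_mul, ih2 k hk (Nat.le_of_succ_le hik),
        horth k hk i hik]
      simp

end AffineRec

/-! ### Moments of the random signs -/

namespace IsRandomSigns

variable {Ω : Type*} [mΩ : MeasurableSpace Ω] {P : Measure Ω} [IsProbabilityMeasure P]
  {F : Filtration ℝ≥0 mΩ} {S : ℕ → Ω → ℝ}

/-- The two probabilities add up to 1, so no other value has positive probability. -/
theorem ae_eq_indicator (hS : IsRandomSigns P F S) (k : ℕ) :
    S k =ᵐ[P] fun ω => {ω | S k ω = 1}.indicator (fun _ => (1 : ℝ)) ω -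
      {ω | S k ω = -1}.indicator (fun _ => (1 : ℝ)) ω := by
  have hm1 : MeasurableSet {ω | S k ω = 1} := hS.measurable k (measurableSet_singleton 1)
  have hm2 : MeasurableSet {ω | S k ω = -1} := hS.measurable k (measurableSet_singleton (-1))
  have hd : Disjoint {ω | S k ω = 1} {ω | S k ω = -1} := by
    rw [Set.disjoint_left]
    intro ω h1 h2
    simp only [mem_ofPred_eq] at h1 h2
    norm_num [h1] at h2
  have h : P ({ω | S k ω = 1} ∪ {ω | S k ω = -1}) = 1 := by
    rw [measure_union hd hm2, hS.prob_one, hS.prob_neg_one, ENNReal.add_halves]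
  filter_upwards [(prob_compl_eq_zero_iff (hm1.union hm2)).2 h |> measure_eq_zero_iff_ae_notMem.1]
    with ω hω
  simp only [mem_compl_iff, not_not, mem_union, mem_ofPred_eq] at hω
  rcases hω with h1 | h1 <;> simp [indicator, h1] <;> norm_num

theorem integral_eq_zero (hS : IsRandomSigns P F S) (k : ℕ) : ∫ ω, S k ω ∂P = 0 := by
  have hm1 : MeasurableSet {ω | S k ω = 1} := hS.measurable k (measurableSet_singleton 1)
  have hm2 : MeasurableSet {ω | S k ω = -1} := hS.measurable k (measurableSet_singleton (-1))
  rw [integral_congr_ae (hS.ae_eq_indicator k), integral_sub ((integrable_const 1).indicator hm1)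
    ((integrable_const 1).indicator hm2), integral_indicator hm1, integral_indicator hm2]
  simp [Measure.real, hS.prob_one, hS.prob_neg_one]

theorem rmsLe (hS : IsRandomSigns P F S) (k : ℕ) : RmsLe P (S k) 1 := by
  have h1 : ∀ᵐ ω ∂P, |S k ω| ≤ 1 := by
    filter_upwards [hS.ae_eq_indicator k] with ω hω
    rw [hω]
    simp only [indicator_apply]
    split_ifs <;> norm_num
  refine ⟨MemLp.of_bound (hS.measurable k).aestronglyMeasurable 1 h1, zero_le_one, ?_⟩
  calc ∫ ω, S k ω ^ 2 ∂P ≤ ∫ _, (1 : ℝ) ∂P := by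
        refine integral_mono_of_nonneg (ae_of_all _ fun _ => sq_nonneg _) (integrable_const _) ?_
        filter_upwards [h1] with ω hω
        exact (sq_le_one_iff_abs_le_one _).2 hω
    _ = 1 ^ 2 := by simp

theorem integral_mul_eq_zero (hS : IsRandomSigns P F S) {j k : ℕ} (h : j ≠ k) :
    ∫ ω, S j ω * S k ω ∂P = 0 := by
  rw [(hS.iIndep.indepFun h).integral_fun_mul_eq_mul_integral
    (hS.measurable j).aestronglyMeasurable (hS.measurable k).aestronglyMeasurable,
    hS.integral_eq_zero, zero_mul]

end IsRandomSigns

/-! ### The Brownian part of the one-step error -/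

/-- The contribution of the noise, apart from the random sign, to the error of one step of the
scheme. -/
noncomputable def stepNoise {Ω : Type*} (A a b b' : ℝ → ℝ) (w : ℝ → Ω → ℝ) (t h : ℝ) (ω : Ω) : ℝ :=
  noiseDefect a b t h * (w (t + h) ω - w t ω) +
    ∫ r in t..(t + h), Real.exp (A (t + h) - A r) * (a r * b r - b' r) * (w r ω - w t ω)

section StepNoise

variable {Ω : Type*} [MeasurableSpace Ω] {P : Measure Ω} [IsProbabilityMeasure P]
  {A a b b' : ℝ → ℝ} {w : ℝ → Ω → ℝ} {t₀ T t h : ℝ}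

theorem continuousOn_propagator_mul (hA : HasContDerivOn A a t₀ T) (hb : HasContDerivOn b b' t₀ T)
    (c : ℝ) : ContinuousOn (fun r => Real.exp (c - A r) * (a r * b r - b' r)) (Icc t₀ T) :=
  (Real.continuous_exp.comp_continuousOn (continuousOn_const.sub hA.continuousOn)).mul
    ((hA.continuousOn_deriv.mul hb.continuousOn).sub hb.continuousOn_deriv)

theorem rmsLe_stepNoise (hw : IsContBrownian P w t₀ T) (hA : HasContDerivOn A a t₀ T)
    (hb : HasContDerivOn b b' t₀ T) (ht : t₀ ≤ t) (hh : 0 ≤ h) (hth : t + h ≤ T) {β Γ : ℝ}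
    (hβ : |noiseDefect a b t h| ≤ β)
    (hΓ : ∀ r ∈ Icc t (t + h), |Real.exp (A (t + h) - A r) * (a r * b r - b' r)| ≤ Γ) :
    RmsLe P (stepNoise A a b b' w t h) ((β + Γ * h) * √h) := by
  have hm : t ∈ Icc t (t + h) := ⟨le_rfl, by linarith⟩
  have h1 := (hw.rmsLe_sub (u := t) (v := t + h) (h := h) ⟨ht, by linarith⟩ ⟨by linarith, hth⟩
    (by rw [add_sub_cancel_left, abs_of_nonneg hh])).const_mul (noiseDefect a b t h)
  have h2 := hw.rmsLe_integral_mul_sub ht hth ((continuousOn_propagator_mul hA hb (A (t + h))).mono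
    (Icc_subset_Icc ht hth)) hm hΓ
  rw [add_sub_cancel_left] at h2
  refine (h1.add h2).mono ?_
  have := mul_le_mul_of_nonneg_right hβ (Real.sqrt_nonneg h)
  linarith

theorem integral_stepNoise_mul_eq_zero (hw : IsContBrownian P w t₀ T)
    (hA : HasContDerivOn A a t₀ T) (hb : HasContDerivOn b b' t₀ T) (ht : t₀ ≤ t) (hh : 0 ≤ h)
    (hth : t + h ≤ T) {Y : Ω → ℝ} (hY : MemLp Y 2 P)
    (h0 : ∀ r ∈ Icc t (t + h), ∫ ω, (w r ω - w t ω) * Y ω ∂P = 0) :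
    ∫ ω, stepNoise A a b b' w t h ω * Y ω ∂P = 0 := by
  have hm : t ∈ Icc t (t + h) := ⟨le_rfl, by linarith⟩
  have hc := (continuousOn_propagator_mul hA hb (A (t + h))).mono (Icc_subset_Icc ht hth)
  obtain ⟨B, hB⟩ := isCompact_Icc.exists_bound_of_continuousOn hc
  have h1 := (hw.rmsLe_integral_mul_sub ht hth hc hm hB).1
  have h2 := hw.memLp_sub (u := t) (v := t + h) ⟨ht, by linarith⟩ ⟨by linarith, hth⟩
  simp only [stepNoise, add_mul, mul_assoc (noiseDefect a b t h)]
  rw [integral_add ((integrable_mul_of_memLp_two h2 hY).const_mul _)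
    (integrable_mul_of_memLp_two h1 hY), integral_const_mul,
    h0 (t + h) ⟨by linarith, le_rfl⟩,
    hw.integral_integral_mul_sub_mul_eq_zero ht hth hc hm hY h0]
  simp

theorem memLp_stepNoise (hw : IsContBrownian P w t₀ T) (hA : HasContDerivOn A a t₀ T)
    (hb : HasContDerivOn b b' t₀ T) (ht : t₀ ≤ t) (hh : 0 ≤ h) (hth : t + h ≤ T) :
    MemLp (stepNoise A a b b' w t h) 2 P := by
  obtain ⟨B, hB⟩ := isCompact_Icc.exists_bound_of_continuousOn
    ((continuousOn_propagator_mul hA hb (A (t + h))).mono (Icc_subset_Icc ht hth))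
  exact (rmsLe_stepNoise hw hA hb ht hh hth le_rfl hB).1

theorem integral_stepNoise (hw : IsContBrownian P w t₀ T) (hA : HasContDerivOn A a t₀ T)
    (hb : HasContDerivOn b b' t₀ T) (ht : t₀ ≤ t) (hh : 0 ≤ h) (hth : t + h ≤ T) :
    ∫ ω, stepNoise A a b b' w t h ω ∂P = 0 := by
  have h := integral_stepNoise_mul_eq_zero hw hA hb ht hh hth (Y := fun _ => 1) (memLp_const 1)
    fun r hr => by
      have h1 : r ∈ Icc t₀ T := ⟨ht.trans hr.1, hr.2.trans hth⟩
      have h2 : t ∈ Icc t₀ T := ⟨ht, by linarith⟩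
      simp only [mul_one]
      rw [integral_sub ((hw.memLp r h1).integrable (by norm_num))
        ((hw.memLp t h2).integrable (by norm_num)), hw.integral_eq_zero r h1,
        hw.integral_eq_zero t h2, sub_zero]
  simpa only [mul_one] using h

/-- Applying `integral_stepNoise_mul_eq_zero` to each factor in turn reduces the claim to increments
over non-overlapping intervals, which are uncorrelated. -/
theorem integral_stepNoise_mul_stepNoise (hw : IsContBrownian P w t₀ T)
    (hA : HasContDerivOn A a t₀ T) (hb : HasContDerivOn b b' t₀ T) (ht : t₀ ≤ t) (hh : 0 ≤ h)
    {t' h' : ℝ} (htt' : t + h ≤ t') (hh' : 0 ≤ h') (hth' : t' + h' ≤ T) :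
    ∫ ω, stepNoise A a b b' w t' h' ω * stepNoise A a b b' w t h ω ∂P = 0 := by
  have hth : t + h ≤ T := by linarith
  have ht' : t₀ ≤ t' := by linarith
  refine integral_stepNoise_mul_eq_zero hw hA hb ht' hh' hth'
    (memLp_stepNoise hw hA hb ht hh hth) fun r hr => ?_
  have hm1 : t' ∈ Icc t₀ T := ⟨ht', by linarith⟩
  have hm2 : r ∈ Icc t₀ T := ⟨ht'.trans hr.1, hr.2.trans hth'⟩
  simp_rw [mul_comm _ (stepNoise A a b b' w t h _)]
  refine integral_stepNoise_mul_eq_zero hw hA hb ht hh hth (hw.memLp_sub hm1 hm2) fun q hq => ?_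
  simp_rw [mul_comm (w q _ - _)]
  exact hw.integral_sub_mul_sub_eq_zero ⟨ht, by linarith⟩ ⟨ht.trans hq.1, hq.2.trans hth⟩ hm1 hm2
    hq.1 (hq.2.trans htt') hr.1

end StepNoise

/-! ### Local and global error of the scheme -/

/-- The paths of `X` satisfy the variation of constants formula with noise path `w`. -/
def HasVariationFormula (A a b b' : ℝ → ℝ) (t₀ T : ℝ) (x w : ℝ → ℝ) : Prop :=
  ∀ s t, t₀ ≤ s → s ≤ t → t ≤ T → x t = Real.exp (A t - A s) * x s + b t * (w t - w s) +
    ∫ r in s..t, Real.exp (A t - A r) * (a r * b r - b' r) * (w r - w s)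

/-- The starting value y is left free: y = X(t) gives the local error, and y = X_k gives the
recursion for the global error. -/
theorem HasVariationFormula.sub_rkStep {Ω : Type*} {W : ℝ≥0 → Ω → ℝ} {X w : ℝ → Ω → ℝ}
    {a A b b' : ℝ → ℝ} {t₀ T : ℝ} {ω : Ω}
    (hX : HasVariationFormula A a b b' t₀ T (X · ω) (w · ω))
    (hwW : ∀ t ∈ Icc t₀ T, w t ω = W t.toNNReal ω) {t h : ℝ} (ht : t₀ ≤ t) (hh : 0 ≤ h)
    (hth : t + h ≤ T) (y σ : ℝ) :
    X (t + h) ω - rkStep (fun t x => a t * x) (fun t _ => b t) t h y (noiseIncr W t h ω) σ =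
      stepFactor a t h * (X t ω - y) + driftDefect A a t h * X t ω +
        stepNoise A a b b' w t h ω + -(noiseDefect a b t h * √h) * σ := by
  have h1 := hX t (t + h) ht (by linarith) hth
  simp only at h1
  rw [rkStep_linear, noiseIncr, ← hwW t ⟨ht, by linarith⟩, ← hwW (t + h) ⟨by linarith, hth⟩, h1]
  simp only [stepNoise, driftDefect]
  ring

/-- The sources are separated because drift terms must be added by the triangle inequality, while
noise and sign terms profit from orthogonality. -/
theorem globalError_eq_affineRec {Ω : Type*} {W : ℝ≥0 → Ω → ℝ} {S : ℕ → Ω → ℝ}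
    {X w : ℝ → Ω → ℝ} {a A b b' : ℝ → ℝ} {t₀ T h : ℝ} {m : ℕ} (hh : 0 ≤ h) (hm : t₀ + m * h ≤ T) {ω : Ω}
    (hX : HasVariationFormula A a b b' t₀ T (X · ω) (w · ω))
    (hwW : ∀ t ∈ Icc t₀ T, w t ω = W t.toNNReal ω) :
    globalError a b W S X t₀ h m ω =
      affineRec (fun k => stepFactor a (t₀ + k * h) h)
        (fun k ω => driftDefect A a (t₀ + k * h) h * X (t₀ + k * h) ω) m ω +
      affineRec (fun k => stepFactor a (t₀ + k * h) h)
        (fun k => stepNoise A a b b' w (t₀ + k * h) h) m ω +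
      affineRec (fun k => stepFactor a (t₀ + k * h) h)
        (fun k ω => -(noiseDefect a b (t₀ + k * h) h * √h) * S k ω) m ω := by
  induction m with
  | zero => simp [globalError, rkScheme, affineRec]
  | succ m ih =>
    have h1 : t₀ + (m + 1 : ℕ) * h = t₀ + m * h + h := by push_cast; ring
    rw [h1] at hm
    have h2 := hX.sub_rkStep hwW (le_add_of_nonneg_right (mul_nonneg (Nat.cast_nonneg m) hh)) hh hm
      (rkScheme (fun t x => a t * x) (fun t _ => b t) t₀ h W S (X t₀) m ω) (S m ω)
    have h3 := ih (by linarith)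
    simp only [globalError, rkScheme, affineRec, h1] at h3 ⊢
    rw [h2, h3]
    ring

section RungeKutta

variable {Ω : Type*} [mΩ : MeasurableSpace Ω] {P : Measure Ω} [IsProbabilityMeasure P]
  {W : ℝ≥0 → Ω → ℝ} {S : ℕ → Ω → ℝ} {X w : ℝ → Ω → ℝ} {a A b b' : ℝ → ℝ} {t₀ T : ℝ}

theorem rmsLe_of_hasVariationFormula {K Γ M : ℝ} (hw : IsContBrownian P w t₀ T)
    (hA : HasContDerivOn A a t₀ T) (hb : HasContDerivOn b b' t₀ T)
    (hX : ∀ᵐ ω ∂P, HasVariationFormula A a b b' t₀ T (X · ω) (w · ω))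
    (hX0 : RmsLe P (X t₀) M) (hKa : ∀ t ∈ Icc t₀ T, |a t| ≤ K) (hKb : ∀ t ∈ Icc t₀ T, |b t| ≤ K)
    (hΓ : ∀ t ∈ Icc t₀ T, ∀ r ∈ Icc t₀ T, |Real.exp (A t - A r) * (a r * b r - b' r)| ≤ Γ)
    {t : ℝ} (ht : t ∈ Icc t₀ T) :
    RmsLe P (X t) (Real.exp (K * (T - t₀)) * M + K * √(T - t₀) +
      (T - t₀) * (Γ * √(T - t₀))) := by
  have ht0 : t₀ ∈ Icc t₀ T := ⟨le_rfl, ht.1.trans ht.2⟩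
  have hL : 0 ≤ T - t₀ := sub_nonneg.2 ht0.2
  have htL : t - t₀ ≤ T - t₀ := by linarith [ht.2]
  have hM := hX0.2.1
  have hΓ0 : 0 ≤ Γ := (abs_nonneg _).trans (hΓ t ht t ht)
  have h1 := hX0.const_mul (Real.exp (A t - A t₀))
  have h2 := (hw.rmsLe_sub (u := t₀) (v := t) (h := T - t₀) ht0 ht
    (by rw [abs_of_nonneg (by linarith [ht.1])]; exact htL)).const_mul (b t)
  have h3 := hw.rmsLe_integral_mul_sub (g := fun r => Real.exp (A t - A r) * (a r * b r - b' r))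
    (s := t₀) (t := t) (c := t₀) (B := Γ) le_rfl ht.2 ((continuousOn_propagator_mul hA hb (A t)).mono
    (Icc_subset_Icc_right ht.2)) ⟨le_rfl, ht.1⟩ fun r hr => hΓ t ht r ⟨hr.1, hr.2.trans ht.2⟩
  refine (((h1.add h2).add h3).congr ?_).mono ?_
  · filter_upwards [hX] with ω hω
    exact (hω t₀ t le_rfl ht.1 ht.2).symm
  · rw [Real.abs_exp]
    have := exp_primitive_sub_le hA hKa ht0 ht
    have := hKb t ht
    gcongr

theorem rmsLe_localError {σ : Ω → ℝ} {CX Γ β α t h : ℝ} (hw : IsContBrownian P w t₀ T)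
    (hwW : ∀ᵐ ω ∂P, ∀ t ∈ Icc t₀ T, w t ω = W t.toNNReal ω)
    (hA : HasContDerivOn A a t₀ T) (hb : HasContDerivOn b b' t₀ T) (hσ : RmsLe P σ 1)
    (hX : ∀ᵐ ω ∂P, HasVariationFormula A a b b' t₀ T (X · ω) (w · ω)) (ht : t₀ ≤ t) (hh : 0 ≤ h)
    (hth : t + h ≤ T) (hCX : RmsLe P (X t) CX) (hα : |driftDefect A a t h| ≤ α)
    (hβ : |noiseDefect a b t h| ≤ β)
    (hΓ : ∀ r ∈ Icc t (t + h), |Real.exp (A (t + h) - A r) * (a r * b r - b' r)| ≤ Γ) :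
    RmsLe P (localError a b W σ X t h) (α * CX + (β + Γ * h) * √h + β * √h) := by
  have h1 := hCX.const_mul (driftDefect A a t h)
  have h2 := rmsLe_stepNoise hw hA hb ht hh hth hβ hΓ
  have h3 := hσ.const_mul (-(noiseDefect a b t h * √h))
  refine (((h1.add h2).add h3).congr ?_).mono ?_
  · filter_upwards [hX, hwW] with ω hω hwω
    rw [localError, hω.sub_rkStep hwω ht hh hth]
    ring
  · rw [abs_neg, abs_mul, abs_of_nonneg (Real.sqrt_nonneg h), mul_one]
    have := hCX.2.1
    gcongr

/-- The noise and sign terms are centred, so only the drift defect contributes to the mean. -/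
theorem abs_integral_localError_le {σ : Ω → ℝ} {CX α t h : ℝ} (hw : IsContBrownian P w t₀ T)
    (hwW : ∀ᵐ ω ∂P, ∀ t ∈ Icc t₀ T, w t ω = W t.toNNReal ω)
    (hA : HasContDerivOn A a t₀ T) (hb : HasContDerivOn b b' t₀ T) (hσ : RmsLe P σ 1)
    (hσ0 : ∫ ω, σ ω ∂P = 0) (hX : ∀ᵐ ω ∂P, HasVariationFormula A a b b' t₀ T (X · ω) (w · ω))
    (ht : t₀ ≤ t) (hh : 0 ≤ h) (hth : t + h ≤ T) (hCX : RmsLe P (X t) CX)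
    (hα : |driftDefect A a t h| ≤ α) :
    |∫ ω, localError a b W σ X t h ω ∂P| ≤ α * CX := by
  have h1 : localError a b W σ X t h =ᵐ[P] fun ω => driftDefect A a t h * X t ω +
      stepNoise A a b b' w t h ω + -(noiseDefect a b t h * √h) * σ ω := by
    filter_upwards [hX, hwW] with ω hω hwω
    rw [localError, hω.sub_rkStep hwω ht hh hth]
    ring
  have hi1 : Integrable (fun ω => driftDefect A a t h * X t ω) P :=
    (hCX.1.integrable (by norm_num)).const_mul _
  have hi2 : Integrable (stepNoise A a b b' w t h) P :=
    (memLp_stepNoise hw hA hb ht hh hth).integrable (by norm_num)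
  have hi3 : Integrable (fun ω => -(noiseDefect a b t h * √h) * σ ω) P :=
    (hσ.1.integrable (by norm_num)).const_mul _
  rw [integral_congr_ae h1, integral_add (f := fun ω => driftDefect A a t h * X t ω +
      stepNoise A a b b' w t h ω) (hi1.add hi2) hi3, integral_add hi1 hi2,
    integral_const_mul, integral_const_mul, integral_stepNoise hw hA hb ht hh hth, hσ0, mul_zero,
    add_zero, add_zero, abs_mul]
  exact mul_le_mul hα hCX.abs_integral_le (abs_nonneg _) ((abs_nonneg _).trans hα)

theorem rmsLe_globalError {F : Filtration ℝ≥0 mΩ} {K Γ CX Cα Cβ Cγ h : ℝ} {m p : ℕ}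
    (hw : IsContBrownian P w t₀ T)
    (hwW : ∀ᵐ ω ∂P, ∀ t ∈ Icc t₀ T, w t ω = W t.toNNReal ω)
    (hA : HasContDerivOn A a t₀ T) (hb : HasContDerivOn b b' t₀ T) (hS : IsRandomSigns P F S)
    (hX : ∀ᵐ ω ∂P, HasVariationFormula A a b b' t₀ T (X · ω) (w · ω))
    (hKa : ∀ t ∈ Icc t₀ T, |a t| ≤ K) (hCX : ∀ t ∈ Icc t₀ T, RmsLe P (X t) CX)
    (hΓ : ∀ t ∈ Icc t₀ T, ∀ r ∈ Icc t₀ T, |Real.exp (A t - A r) * (a r * b r - b' r)| ≤ Γ)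
    (hCα : 0 ≤ Cα) (hCβ : 0 ≤ Cβ) (hCγ : 0 ≤ Cγ)
    (hα : ∀ t, t₀ ≤ t → t + h ≤ T → |driftDefect A a t h| ≤ Cα * h ^ (p + 1))
    (hβ : ∀ t, t₀ ≤ t → t + h ≤ T → |noiseDefect a b t h| ≤ Cβ * h ^ p)
    (hΓp : h ≤ T - t₀ → Γ * h ≤ Cγ * h ^ p) (hh : 0 < h) (hm : t₀ + m * h ≤ T) :
    RmsLe P (globalError a b W S X t₀ h m) (Real.exp (K * (T - t₀)) *
      ((T - t₀) * (Cα * CX) + √(T - t₀) * (Cβ + Cγ) + √(T - t₀) * Cβ) * h ^ p) := by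
  have hmh : 0 ≤ m * h := mul_nonneg (Nat.cast_nonneg m) hh.le
  have ht0 : t₀ ∈ Icc t₀ T := ⟨le_rfl, by linarith⟩
  have hK0 : 0 ≤ K := (abs_nonneg _).trans (hKa t₀ ht0)
  have hCX0 : 0 ≤ CX := (hCX t₀ ht0).2.1
  have hk0 : ∀ k : ℕ, t₀ ≤ t₀ + k * h := fun k =>
    le_add_of_nonneg_right (mul_nonneg (Nat.cast_nonneg k) hh.le)
  have hkT : ∀ k < m, t₀ + k * h + h ≤ T := fun k hk => by
    have : ((k + 1 : ℕ) : ℝ) * h ≤ m * h := mul_le_mul_of_nonneg_right (Nat.cast_le.2 hk) hh.le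
    push_cast at this
    linarith
  have hkm : ∀ k < m, t₀ + k * h ∈ Icc t₀ T := fun k hk => ⟨hk0 k, by linarith [hkT k hk]⟩
  have hg : 1 ≤ Real.exp (K * h) := Real.one_le_exp (mul_nonneg hK0 hh.le)
  have hG : ∀ k < m, |stepFactor a (t₀ + k * h) h| ≤ Real.exp (K * h) := fun k hk =>
    abs_stepFactor_le hKa (hk0 k) hh.le (hkT k hk)
  have hU := rmsLe_affineRec (P := P) (c := Cα * h ^ (p + 1) * CX)
    (N := fun k ω => driftDefect A a (t₀ + k * h) h * X (t₀ + k * h) ω) hg (by positivity) hG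
    fun k hk => ((hCX _ (hkm k hk)).const_mul _).mono
      (mul_le_mul_of_nonneg_right (hα _ (hk0 k) (hkT k hk)) hCX0)
  have hV := rmsLe_affineRec_of_orthogonal (P := P) (c := (Cβ + Cγ) * h ^ p * √h)
    (N := fun k => stepNoise A a b b' w (t₀ + k * h) h) hg (by positivity) hG
    (fun k hk => by
      refine (rmsLe_stepNoise hw hA hb (hk0 k) hh.le (hkT k hk) (hβ _ (hk0 k) (hkT k hk))
        fun r hr => hΓ _ ⟨by linarith [hk0 k], hkT k hk⟩ r
          ⟨(hk0 k).trans hr.1, hr.2.trans (hkT k hk)⟩).mono ?_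
      refine mul_le_mul_of_nonneg_right ?_ (Real.sqrt_nonneg h)
      linarith [hΓp (by linarith [hk0 k, hkT k hk])])
    fun k hk j hj => by
      refine integral_stepNoise_mul_stepNoise hw hA hb (hk0 j) hh.le ?_ hh.le (hkT k hk)
      have : ((j + 1 : ℕ) : ℝ) * h ≤ k * h := mul_le_mul_of_nonneg_right (Nat.cast_le.2 hj) hh.le
      push_cast at this
      linarith
  have hQ := rmsLe_affineRec_of_orthogonal (P := P) (c := Cβ * h ^ p * √h)
    (N := fun k ω => -(noiseDefect a b (t₀ + k * h) h * √h) * S k ω) hg (by positivity) hG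
    (fun k hk => by
      refine ((hS.rmsLe k).const_mul _).mono ?_
      rw [abs_neg, abs_mul, abs_of_nonneg (Real.sqrt_nonneg h), mul_one]
      exact mul_le_mul_of_nonneg_right (hβ _ (hk0 k) (hkT k hk)) (Real.sqrt_nonneg h))
    fun k hk j hj => by
      simp only [mul_mul_mul_comm _ (S k _)]
      rw [integral_const_mul, hS.integral_mul_eq_zero hj.ne', mul_zero]
  refine (((hU.add hV).add hQ).congr ?_).mono ?_
  · filter_upwards [hX, hwW] with ω hω hwω
    exact (globalError_eq_affineRec hh.le hm hω hwω).symm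
  -- The number of steps enters only through m h ≤ T - t₀: as mh for the drift, as √m √h for the
  -- orthogonal sums, and in the exponent of exp(Kh)^m.
  · have hmL : m * h ≤ T - t₀ := by linarith
    have hE : Real.exp (K * h) ^ m ≤ Real.exp (K * (T - t₀)) := by
      rw [← Real.exp_nat_mul, Real.exp_le_exp]
      calc m * (K * h) = K * (m * h) := by ring
        _ ≤ K * (T - t₀) := by gcongr
    have hsq : √m * √h ≤ √(T - t₀) := by
      rw [← Real.sqrt_mul (Nat.cast_nonneg m)]
      exact Real.sqrt_le_sqrt hmL
    calc _ = Real.exp (K * h) ^ m * ((m * h) * (Cα * CX) + (√m * √h) * (Cβ + Cγ) +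
          (√m * √h) * Cβ) * h ^ p := by ring
      _ ≤ _ := by gcongr

/-- Error bounds of order `p` for the scheme, from bounds for the defects of its coefficients. -/
theorem exists_rk_error_bound {p : ℕ} {K Γ Cα Cβ Cγ : ℝ} (M : ℝ) (ht₀ : 0 ≤ t₀) (hT : t₀ < T)
    (hA : HasContDerivOn A a t₀ T) (hb : HasContDerivOn b b' t₀ T)
    (hKa : ∀ t ∈ Icc t₀ T, |a t| ≤ K) (hKb : ∀ t ∈ Icc t₀ T, |b t| ≤ K)
    (hΓ : ∀ t ∈ Icc t₀ T, ∀ r ∈ Icc t₀ T, |Real.exp (A t - A r) * (a r * b r - b' r)| ≤ Γ)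
    (hCα : 0 ≤ Cα) (hCβ : 0 ≤ Cβ) (hCγ : 0 ≤ Cγ)
    (hα : ∀ t h, t₀ ≤ t → 0 ≤ h → t + h ≤ T → |driftDefect A a t h| ≤ Cα * h ^ (p + 1))
    (hβ : ∀ t h, t₀ ≤ t → 0 ≤ h → t + h ≤ T → |noiseDefect a b t h| ≤ Cβ * h ^ p)
    (hΓp : ∀ h, 0 ≤ h → h ≤ T - t₀ → Γ * h ≤ Cγ * h ^ p) :
    ∃ C : ℝ, ∀ (Ω : Type*) [mΩ : MeasurableSpace Ω] (P : Measure Ω) [IsProbabilityMeasure P]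
      (F : Filtration ℝ≥0 mΩ) (W : ℝ≥0 → Ω → ℝ) (S : ℕ → Ω → ℝ) (X : ℝ → Ω → ℝ),
      IsFilteredBrownian P F W → IsRandomSigns P F S →
      IsLinearSDESolution P F W a b t₀ T X → eLpNorm (X t₀) 2 P ≤ ENNReal.ofReal M →
      (∀ (h : ℝ) (m : ℕ), 0 < h → t₀ + m * h ≤ T →
        eLpNorm (globalError a b W S X t₀ h m) 2 P ≤ ENNReal.ofReal (C * h ^ p)) ∧
      (∀ (t h : ℝ) (k : ℕ), t₀ ≤ t → 0 < h → t + h ≤ T →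
        MemLp (localError a b W (S k) X t h) 2 P ∧
        |∫ ω, localError a b W (S k) X t h ω ∂P| ≤ C * h ^ (p + 1) ∧
        variance (localError a b W (S k) X t h) P ≤ C * h ^ (2 * p + 1)) := by
  have ht0 : t₀ ∈ Icc t₀ T := ⟨le_rfl, hT.le⟩
  have hL : 0 ≤ T - t₀ := sub_nonneg.2 hT.le
  have hK0 : 0 ≤ K := (abs_nonneg _).trans (hKa t₀ ht0)
  have hΓ0 : 0 ≤ Γ := (abs_nonneg _).trans (hΓ t₀ ht0 t₀ ht0)
  -- `M` may be negative; `ENNReal.ofReal` truncates it at 0, hence `max M 0`.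
  set CX := Real.exp (K * (T - t₀)) * max M 0 + K * √(T - t₀) + (T - t₀) * (Γ * √(T - t₀))
    with hCXdef
  have hCX0 : 0 ≤ CX := by positivity
  set C1 := Real.exp (K * (T - t₀)) *
    ((T - t₀) * (Cα * CX) + √(T - t₀) * (Cβ + Cγ) + √(T - t₀) * Cβ) with hC1def
  have hC1 : 0 ≤ C1 := by positivity
  set C2 := Cα * CX * √(T - t₀) + (Cβ + Cγ) + Cβ with hC2def
  have hC3 : 0 ≤ Cα * CX := by positivity
  -- One constant for all three bounds: C1 for the global error, C2² for the variance, and Cα CX for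
  -- the mean of the local error.
  refine ⟨C1 + C2 ^ 2 + Cα * CX, fun Ω _ P _ F W S X hW hS hXsol hX0 => ?_⟩
  obtain ⟨w, hw, hwW⟩ := hW.exists_isContBrownian ht₀ hT.le
  have hX : ∀ᵐ ω ∂P, HasVariationFormula A a b b' t₀ T (X · ω) (w · ω) :=
    hXsol.variation_of_constants ht₀ hT.le hA hb hw hwW
  have hX0' : RmsLe P (X t₀) (max M 0) := by
    refine (rmsLe_iff ⟨?_, hX0.trans_lt ENNReal.ofReal_lt_top⟩ (le_max_right _ _)).2
      (hX0.trans (ENNReal.ofReal_le_ofReal (le_max_left _ _)))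
    exact ((hXsol.adapted t₀ ht0).mono (F.le _)).aestronglyMeasurable
  have hCX : ∀ t ∈ Icc t₀ T, RmsLe P (X t) CX := fun t ht =>
    rmsLe_of_hasVariationFormula hw hA hb hX hX0' hKa hKb hΓ ht
  refine ⟨fun h m hh hm => ?_, fun t h k ht hh hth => ?_⟩
  · have h1 := rmsLe_globalError hw hwW hA hb hS hX hKa hCX hΓ hCα hCβ hCγ
      (fun t ht hth => hα t h ht hh.le hth) (fun t ht hth => hβ t h ht hh.le hth)
      (hΓp h hh.le) hh hm
    refine (h1.mono ?_).eLpNorm_le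
    gcongr
    rw [← hC1def]
    linarith [sq_nonneg C2]
  · have hm : t ∈ Icc t₀ T := ⟨ht, by linarith⟩
    have hhL : h ≤ T - t₀ := by linarith
    have h1 := rmsLe_localError hw hwW hA hb (hS.rmsLe k) hX ht hh.le hth (hCX t hm)
      (hα t h ht hh.le hth) (hβ t h ht hh.le hth)
      fun r hr => hΓ _ ⟨by linarith, hth⟩ r ⟨ht.trans hr.1, hr.2.trans hth⟩
    have h2 := abs_integral_localError_le hw hwW hA hb (hS.rmsLe k) (hS.integral_eq_zero k) hX ht
      hh.le hth (hCX t hm) (hα t h ht hh.le hth)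
    refine ⟨h1.1, h2.trans ?_, ?_⟩
    · calc Cα * h ^ (p + 1) * CX = Cα * CX * h ^ (p + 1) := by ring
        _ ≤ _ := by
          gcongr
          linarith [sq_nonneg C2]
    · have h3 : Cα * h ^ (p + 1) * CX + (Cβ * h ^ p + Γ * h) * √h + Cβ * h ^ p * √h ≤
          C2 * h ^ p * √h := by
        -- One factor h is split as √h √h, and one of the roots is absorbed into √(T - t₀), bringing
        -- the drift term to the size h^p √h of the other two.
        have h4 : Cα * h ^ (p + 1) * CX ≤ Cα * CX * √(T - t₀) * h ^ p * √h := by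
          calc Cα * h ^ (p + 1) * CX = Cα * CX * (√h * √h) * h ^ p := by
                rw [Real.mul_self_sqrt hh.le]; ring
            _ ≤ Cα * CX * (√(T - t₀) * √h) * h ^ p := by gcongr
            _ = _ := by ring
        have h5 := mul_le_mul_of_nonneg_right (hΓp h hh.le hhL) (Real.sqrt_nonneg h)
        rw [hC2def]
        linarith
      have h6 := (variance_le_expectation_sq h1.1.1).trans (h1.mono h3).2.2
      refine h6.trans ?_
      calc (C2 * h ^ p * √h) ^ 2 = C2 ^ 2 * h ^ (2 * p + 1) := by
            rw [mul_pow, Real.sq_sqrt hh.le]; ring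
        _ ≤ _ := by
          gcongr
          linarith

end RungeKutta

/-! ### The two cases: order one in general, order two for exact differentials -/

theorem mainTheorem3 (a b : ℝ → ℝ) (t₀ T : ℝ) (ht₀ : 0 ≤ t₀) (hT : t₀ < T)
    (ha : TwiceDifferentiableOn a t₀ T) (hb : TwiceDifferentiableOn b t₀ T) (M : ℝ) :
    -- general case: the root mean square global error is `O(h)`
    (∃ C : ℝ, ∀ (Ω : Type*) [mΩ : MeasurableSpace Ω] (P : Measure Ω) [IsProbabilityMeasure P]
        (F : Filtration ℝ≥0 mΩ) (W : ℝ≥0 → Ω → ℝ) (S : ℕ → Ω → ℝ) (X : ℝ → Ω → ℝ),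
        IsFilteredBrownian P F W → IsRandomSigns P F S →
        IsLinearSDESolution P F W a b t₀ T X → eLpNorm (X t₀) 2 P ≤ ENNReal.ofReal M →
        ∀ (h : ℝ) (m : ℕ), 0 < h → t₀ + m * h ≤ T →
          eLpNorm (globalError a b W S X t₀ h m) 2 P ≤ ENNReal.ofReal (C * h)) ∧
    -- exact differential case `a b = db/dt`
    ((∀ t ∈ Icc t₀ T, a t * b t = derivWithin b (Icc t₀ T) t) →
      -- `X = b(t) W` is a solution
      (∀ (Ω : Type*) [mΩ : MeasurableSpace Ω] (P : Measure Ω) [IsProbabilityMeasure P]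
        (F : Filtration ℝ≥0 mΩ) (W : ℝ≥0 → Ω → ℝ), IsFilteredBrownian P F W →
        IsLinearSDESolution P F W a b t₀ T (fun t ω => b t * W t.toNNReal ω)) ∧
      -- the root mean square global error is `O(h²)`, and the local error has
      -- mean `O(h³)` and variance `O(h⁵)`
      ((∃ B : ℝ, ∀ t ∈ Icc t₀ T,
          |derivWithin (derivWithin a (Icc t₀ T)) (Icc t₀ T) t| ≤ B) →
        ∃ C : ℝ, ∀ (Ω : Type*) [mΩ : MeasurableSpace Ω] (P : Measure Ω)
          [IsProbabilityMeasure P] (F : Filtration ℝ≥0 mΩ) (W : ℝ≥0 → Ω → ℝ)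
          (S : ℕ → Ω → ℝ) (X : ℝ → Ω → ℝ),
          IsFilteredBrownian P F W → IsRandomSigns P F S →
          IsLinearSDESolution P F W a b t₀ T X → eLpNorm (X t₀) 2 P ≤ ENNReal.ofReal M →
          (∀ (h : ℝ) (m : ℕ), 0 < h → t₀ + m * h ≤ T →
            eLpNorm (globalError a b W S X t₀ h m) 2 P ≤ ENNReal.ofReal (C * h ^ 2)) ∧
          (∀ (t h : ℝ) (k : ℕ), t₀ ≤ t → 0 < h → t + h ≤ T →
            MemLp (localError a b W (S k) X t h) 2 P ∧
            |∫ ω, localError a b W (S k) X t h ω ∂P| ≤ C * h ^ 3 ∧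
            variance (localError a b W (S k) X t h) P ≤ C * h ^ 5))) := by
  
  have haC := ha.hasContDerivOn
  have hbC := hb.hasContDerivOn
  set a' := derivWithin a (Icc t₀ T) with ha'
  set b' := derivWithin b (Icc t₀ T) with hb'
  have hA := HasContDerivOn.primitive hT.le haC.continuousOn
  set A : ℝ → ℝ := fun r => ∫ u in t₀..r, a u
  obtain ⟨K, hKa, hKa', hKb, hKb'⟩ : ∃ K, (∀ t ∈ Icc t₀ T, |a t| ≤ K) ∧
      (∀ t ∈ Icc t₀ T, |a' t| ≤ K) ∧ (∀ t ∈ Icc t₀ T, |b t| ≤ K) ∧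
      ∀ t ∈ Icc t₀ T, |b' t| ≤ K := by
    obtain ⟨K1, h1⟩ := isCompact_Icc.exists_bound_of_continuousOn haC.continuousOn
    obtain ⟨K2, h2⟩ := isCompact_Icc.exists_bound_of_continuousOn haC.continuousOn_deriv
    obtain ⟨K3, h3⟩ := isCompact_Icc.exists_bound_of_continuousOn hbC.continuousOn
    obtain ⟨K4, h4⟩ := isCompact_Icc.exists_bound_of_continuousOn hbC.continuousOn_deriv
    refine ⟨max (max K1 K2) (max K3 K4), fun t ht => (h1 t ht).trans ?_,
      fun t ht => (h2 t ht).trans ?_, fun t ht => (h3 t ht).trans ?_,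
      fun t ht => (h4 t ht).trans ?_⟩ <;> simp
  have ht0 : t₀ ∈ Icc t₀ T := ⟨le_rfl, hT.le⟩
  have hL : 0 ≤ T - t₀ := sub_nonneg.2 hT.le
  have hK0 : 0 ≤ K := (abs_nonneg _).trans (hKa t₀ ht0)
  refine ⟨?_, fun hab => ⟨fun Ω _ P _ F W hW =>
    isLinearSDESolution_mul_brownian hW ht₀ hT.le hbC hab, fun ⟨B, hB⟩ => ?_⟩⟩
  · obtain ⟨C, hC⟩ := exists_rk_error_bound (p := 1) M ht₀ hT hA hbC hKa hKb
      (fun t ht r hr => abs_exp_mul_sub_le hA hKa hKb hKb' hr ht)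
      (Cα := K ^ 2 * Real.exp (K * (T - t₀)) + K + K ^ 2) (Cβ := K + K ^ 2)
      (Cγ := Real.exp (K * (T - t₀)) * (K ^ 2 + K)) (by positivity) (by positivity) (by positivity)
      (fun t h ht hh hth => abs_driftDefect_le hA haC hKa hKa' ht hh hth)
      (fun t h ht hh hth => by
        simpa only [pow_one] using abs_noiseDefect_le hbC hKa hKb hKb' ht hh hth)
      (fun h _ _ => by rw [pow_one])
    refine ⟨C, fun Ω _ P _ F W S X hW hS hX hX0 h m hh hm => ?_⟩
    simpa only [pow_one] using (hC Ω P F W S X hW hS hX hX0).1 h m hh hm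
  · have hB0 : 0 ≤ B := (abs_nonneg _).trans (hB t₀ ht0)
    -- Here ab - b' vanishes, so Γ = Cγ = 0. The bound on the second derivative of a enters only as
    -- a Lipschitz constant of a'.
    exact exists_rk_error_bound (p := 2) M ht₀ hT hA hbC hKa hKb (Γ := 0)
      (fun t ht r hr => by rw [hab r hr, sub_self, mul_zero, abs_zero])
      (Cα := K ^ 3 * Real.exp (K * (T - t₀)) + B + B * K * (T - t₀) + K ^ 2 * (T - t₀))
      (Cβ := K ^ 2) (Cγ := 0) (by positivity) (by positivity) le_rfl
      (fun t h ht hh hth => abs_driftDefect_le_of_lipschitz hA haC hKa hKa' hB0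
        (fun x hx y hy => abs_derivWithin_sub_le ha.2 hB hx hy) ht hh hth)
      (fun t h ht hh hth =>
        abs_noiseDefect_le_of_exact haC hbC hab hKa hKa' hKb hKb' ht hh hth)
      (fun h _ _ => by simp)
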